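/- Let $\mathfrak g$ be a finite-dimensional simple complex Lie algebra with a Cartan subalgebra $\mathfrak h$ and simple roots $\alpha_1,\dots,\alpha_r$. Let $\mathfrak n=\bigoplus_{\beta>0}\mathfrak n_\beta$, where $\mathfrak n_\beta=\mathfrak g_{-\beta}$ is the root space of $-\beta$, with Chevalley generators $0\neq f_i\in\mathfrak n_{\alpha_i}$. Enumerate the positive roots in any fixed order $\beta_1,\dots,\beta_m$ and choose $0\ne F_{\beta_l}\in\mathfrak n_{\beta_l}$. For $k\in\mathbb N^r$ let $|k|=\sum_i k_i$ and consider variables $t^{(i)}_j$ ($1\le i\le r$, $1\le j\le k_i$), permuted by $G_k=\prod_i\Sigma_{k_i}$. Put $\mathrm{Sym}_k x=\sum_{\pi\in G_k}\pi\cdot x$ and $dV_k=dt^{(1)}_1\wedge\dots\wedge dt^{(1)}_{k_1}\wedge dt^{(2)}_1\wedge\dots\wedge dt^{(r)}_{k_r}$. For a $G_k$-symmetric rational function $f$ and a $G_l$-symmetric one $g$, the star product $f*g$ is the $G_{k+l}$-symmetric function $$f*g=\frac{1}{\prod_i k_i!\,l_i!}\,\mathrm{Sym}_{k+l}\Big(f\big((t^{(i)}_j)_{j\le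 k_i}\big)\cdot g\big((t^{(i)}_{k_i+j})_{j\le l_i}\big)\Big);$$ the empty star product is the constant $1$ (of degree $0$). Let $\mathcal A^{G_k}$ be the space of forms $R\,dV_k$ of degree $|k|$, with $R$ a $G_k$-symmetric rational function, that lie in the $\mathbb C$-algebra generated by $df/f$, where $f$ runs over all variables and all differences of two distinct variables. Let $U_r$ be the free associative algebra on $\tilde f_1,\dots,\tilde f_r$ and $U_r[k]$ its part of multidegree $k$, with basis the words $\tilde f_J=\tilde f_{J(|k|)}\cdots\tilde f_{J(1)}$, where $J:\{1,\dots,|k|\}\to\{1,\dots,r\}$ and $\#J^{-1}(i)=k_i$. Pair $\mathcal A^{G_k}$ with $U_r[k]$ by letting $\tilde f_J$ act as the iterated residue along $$\frac1{\prod_i k_i!}\sum_{e}\mathrm{sgn}(e)\,\big[(t_{e(1)}=0)\supset(t_{e(1)}=t_{e(2)}=0)\supset\cdots\supset(t_{e(1)}=\dots=t_{e(|k|)}=0)\big],$$ the sum being over the enumerations $e$ of the variables in which the $u$-th variable has upper index $J(u)$, and $\mathrm{sgn}(e)$ being given by $dt_{e(1)}\wedge\dots\wedge dt_{e(|k|)}=\mathrm{sgn}(e)\,dV_k$.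 Let $\Omega_k\in\mathcal A^{G_k}\otimes U_r[k]$ be the canonical element of this pairing (the element whose contraction with every $x\in U_r[k]$ is $x$), and let $\Omega^{\mathfrak g}_k\in\mathcal A^{G_k}\otimes U(\mathfrak n)$ be its image under $\mathrm{id}\otimes q$, where $q:U_r\to U(\mathfrak n)$, $\tilde f_i\mapsto f_i$. An element of $q(U_r[k])$ is said to have content $k$. **Theorem (Product formula).** Each $F_{\beta_l}$ has a unique content $k^{(l)}$, the canonical element $\Omega_k$ exists and is unique for every $k$, and $\Omega^{\mathfrak g}_k$ has a unique expansion $$\Omega^{\mathfrak g}_k=\sum_p\omega_p\,dV_k\otimes F_{\beta_1}^{p_1}\cdots F_{\beta_m}^{p_m},\qquad \omega_p\,dV_k\in\mathcal A^{G_k},$$ over the $p\in\mathbb N^m$ for which $F_{\beta_1}^{p_1}\cdots F_{\beta_m}^{p_m}$ has content $k$. There exist rational functions $\eta_{\beta_l}$ in the variables $t^{(i)}_j$, $1\le j\le k^{(l)}_i$, symmetric under $G_{k^{(l)}}$ ($l=1,\dots,m$), such that for every $k$ and every $p\in\mathbb N^m$ for which $F_{\beta_1}^{p_1}\cdots F_{\beta_m}^{p_m}$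 has content $k$, $$\omega_p=\frac{1}{\prod_l p_l!}\cdot\overbrace{\eta_{\beta_1}*\dots*\eta_{\beta_1}}^{p_1}*\overbrace{\eta_{\beta_2}*\dots*\eta_{\beta_2}}^{p_2}*\dots*\overbrace{\eta_{\beta_m}*\dots*\eta_{\beta_m}}^{p_m}.$$ -/

import Mathlib

open scoped TensorProduct

noncomputable section

namespace CanonicalForm

/-! ### Rational functions, substitution of variables, residues along coordinate hyperplanes -/

/-- The field of rational functions over `ℂ` in the variables `t_a`, `a ∈ σ`. -/
abbrev RatFn (σ : Type) : Type := FractionRing (MvPolynomial σ ℂ)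

/-- The variable `t_a` as a rational function. -/
def tvar {σ : Type} (a : σ) : RatFn σ :=
  algebraMap (MvPolynomial σ ℂ) (RatFn σ) (MvPolynomial.X a)

/-- The substitution `t_a ↦ t_{e a}` for an injective `e`. -/
def ratRename {σ τ : Type} (e : σ → τ) (he : Function.Injective e) : RatFn σ →+* RatFn τ :=
  IsFractionRing.map (A := MvPolynomial σ ℂ) (B := MvPolynomial τ ℂ)
    (j := (MvPolynomial.rename e : MvPolynomial σ ℂ →ₐ[ℂ] MvPolynomial τ ℂ).toRingHom)
    (MvPolynomial.rename_injective e he)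

/-- A polynomial seen as a polynomial in the one variable `t_a`, with coefficients that are
rational functions of the other variables. -/
def polyAt {σ : Type} [DecidableEq σ] (a : σ) :
    MvPolynomial σ ℂ →ₐ[ℂ] Polynomial (RatFn σ) :=
  MvPolynomial.aeval fun b => if b = a then Polynomial.X else Polynomial.C (tvar b)

lemma polyAt_injective {σ : Type} [DecidableEq σ] (a : σ) :
    Function.Injective (polyAt a) := by
  have h : ∀ P : MvPolynomial σ ℂ,
      Polynomial.aeval (tvar a) (polyAt a P) = algebraMap _ (RatFn σ) P := by
    intro P
    induction P using MvPolynomial.induction_on with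
    | C c =>
      have hc : (MvPolynomial.C c : MvPolynomial σ ℂ) = algebraMap ℂ _ c := rfl
      rw [hc, AlgHom.commutes, IsScalarTower.algebraMap_apply ℂ (RatFn σ) (Polynomial (RatFn σ)),
        AlgHom.commutes, ← IsScalarTower.algebraMap_apply ℂ (MvPolynomial σ ℂ) (RatFn σ)]
      rfl
    | add p q hp hq => simp only [map_add, hp, hq]
    | mul_X p b hp =>
      rw [map_mul, map_mul, hp, map_mul]
      congr 1
      by_cases hb : b = a <;> simp [polyAt, tvar, hb]
  intro P Q hPQ
  apply IsFractionRing.injective (MvPolynomial σ ℂ) (RatFn σ)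
  rw [← h, ← h, hPQ]

/-- The inclusion of polynomials, seen as polynomials in `t_a`, into Laurent series in `t_a`. -/
def polyLaurent {σ : Type} [DecidableEq σ] (a : σ) :
    MvPolynomial σ ℂ →+* LaurentSeries (RatFn σ) :=
  ((HahnSeries.ofPowerSeries ℤ (RatFn σ)).comp
    (Polynomial.coeToPowerSeries.ringHom)).comp (polyAt a).toRingHom

lemma polyLaurent_injective {σ : Type} [DecidableEq σ] (a : σ) :
    Function.Injective (polyLaurent a) := by
  intro P Q h
  have h' : HahnSeries.ofPowerSeries ℤ (RatFn σ) ((polyAt a P : Polynomial (RatFn σ))) =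
      HahnSeries.ofPowerSeries ℤ (RatFn σ) ((polyAt a Q : Polynomial (RatFn σ))) := h
  exact polyAt_injective a (Polynomial.coe_injective (RatFn σ)
    (HahnSeries.ofPowerSeries_injective (Γ := ℤ) h'))

/-- The Laurent expansion of a rational function at `t_a = 0`, in powers of `t_a`, with
coefficients that are rational functions of the other variables. -/
def laurentAt {σ : Type} [DecidableEq σ] (a : σ) : RatFn σ →+* LaurentSeries (RatFn σ) :=
  IsFractionRing.lift (A := MvPolynomial σ ℂ) (K := RatFn σ) (L := LaurentSeries (RatFn σ))
    (g := polyLaurent a) (polyLaurent_injective a)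

lemma laurentAt_smul {σ : Type} [DecidableEq σ] (a : σ) (c : ℂ) (R : RatFn σ) :
    laurentAt a (c • R) = algebraMap ℂ (RatFn σ) c • laurentAt a R := by
  have h : laurentAt a (algebraMap ℂ (RatFn σ) c) = HahnSeries.C (algebraMap ℂ (RatFn σ) c) := by
    rw [IsScalarTower.algebraMap_apply ℂ (MvPolynomial σ ℂ) (RatFn σ), laurentAt,
      IsFractionRing.lift_algebraMap (K := RatFn σ) (L := LaurentSeries (RatFn σ))
        (g := polyLaurent a) (polyLaurent_injective a), polyLaurent]
    have h2 : (polyAt a) (algebraMap ℂ (MvPolynomial σ ℂ) c) =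
        Polynomial.C (algebraMap ℂ (RatFn σ) c) := AlgHom.commutes _ _
    simp only [RingHom.comp_apply, AlgHom.toRingHom_eq_coe, RingHom.coe_coe, h2]
    rw [Polynomial.coeToPowerSeries.ringHom_apply, Polynomial.coe_C, HahnSeries.ofPowerSeries_C,
      ← IsScalarTower.algebraMap_apply ℂ (MvPolynomial σ ℂ) (RatFn σ)]
  rw [Algebra.smul_def, map_mul, h, HahnSeries.C_mul_eq_smul]

/-- The residue of `R dt_a` along `t_a = 0`: the coefficient of `t_a⁻¹` in the expansion of `R`. -/
def resAt {σ : Type} [DecidableEq σ] (a : σ) : RatFn σ →ₗ[ℂ] RatFn σ where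
  toFun R := (laurentAt a R).coeff (-1)
  map_add' R S := by simp
  map_smul' c R := by
    rw [laurentAt_smul, HahnSeries.coeff_smul, RingHom.id_apply, smul_eq_mul, ← Algebra.smul_def]

/-- The iterated residue of `R dt_{e 0} ∧ ⋯ ∧ dt_{e (n-1)}` with respect to the flag
`ℂⁿ ⊃ (t_{e 0} = 0) ⊃ (t_{e 0} = t_{e 1} = 0) ⊃ ⋯`: first the residue along `t_{e 0} = 0`, then
along `t_{e 1} = 0`, and so on.  The value is a constant function. -/
def iterRes {σ : Type} [DecidableEq σ] {n : ℕ} (e : Fin n ≃ σ) : RatFn σ →ₗ[ℂ] RatFn σ :=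
  (List.ofFn e).foldl (fun φ a => resAt a ∘ₗ φ) LinearMap.id

/-! ### Variables `t^{(i)}_j` and the star multiplication -/

/-- The variables `t^{(i)}_j`, `1 ≤ i ≤ r`, `1 ≤ j ≤ k_i`. -/
abbrev Vars {r : ℕ} (k : Fin r → ℕ) : Type := (i : Fin r) × Fin (k i)

/-- The group `G_k = ∏ᵢ Σ_{k_i}`. -/
abbrev GroupG {r : ℕ} (k : Fin r → ℕ) : Type := (i : Fin r) → Equiv.Perm (Fin (k i))

/-- The action of `G_k` by permutation of the variables with the same upper index. -/
def permute {r : ℕ} {k : Fin r → ℕ} (π : GroupG k) : RatFn (Vars k) →+* RatFn (Vars k) :=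
  ratRename (Equiv.sigmaCongrRight π) (Equiv.sigmaCongrRight π).injective

/-- Symmetry under `G_k`. -/
def IsSymm {r : ℕ} {k : Fin r → ℕ} (R : RatFn (Vars k)) : Prop :=
  ∀ π : GroupG k, permute π R = R

/-- The symmetrizer `Sym_k`. -/
def symmetrize {r : ℕ} {k : Fin r → ℕ} (R : RatFn (Vars k)) : RatFn (Vars k) :=
  ∑ π : GroupG k, permute π R

/-- `t^{(i)}_j ↦ t^{(i)}_j`. -/
def inclLeft {r : ℕ} (k l : Fin r → ℕ) (a : Vars k) : Vars (k + l) :=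
  ⟨a.1, Fin.castAdd (l a.1) a.2⟩

/-- `t^{(i)}_j ↦ t^{(i)}_{k_i + j}`. -/
def inclRight {r : ℕ} (k l : Fin r → ℕ) (a : Vars l) : Vars (k + l) :=
  ⟨a.1, Fin.natAdd (k a.1) a.2⟩

lemma inclLeft_injective {r : ℕ} (k l : Fin r → ℕ) : Function.Injective (inclLeft k l) := by
  rintro ⟨i, x⟩ ⟨j, y⟩ h
  obtain rfl : i = j := congrArg Sigma.fst h
  have h2 := eq_of_heq (Sigma.mk.inj_iff.mp h).2
  exact congrArg (Sigma.mk i) (Fin.castAdd_injective _ _ h2)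

lemma inclRight_injective {r : ℕ} (k l : Fin r → ℕ) : Function.Injective (inclRight k l) := by
  rintro ⟨i, x⟩ ⟨j, y⟩ h
  obtain rfl : i = j := congrArg Sigma.fst h
  have h2 := eq_of_heq (Sigma.mk.inj_iff.mp h).2
  exact congrArg (Sigma.mk i) (Fin.natAdd_injective _ _ h2)

/-- The star product of a function of degree `k` and a function of degree `l`. -/
def star {r : ℕ} {k l : Fin r → ℕ} (f : RatFn (Vars k)) (g : RatFn (Vars l)) :
    RatFn (Vars (k + l)) :=
  (∏ i, ((k i).factorial * (l i).factorial : ℂ))⁻¹ •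
    symmetrize (ratRename (inclLeft k l) (inclLeft_injective k l) f *
      ratRename (inclRight k l) (inclRight_injective k l) g)

/-- A rational function together with its degree `k ∈ ℕʳ`. -/
abbrev GradedFn (r : ℕ) : Type := (k : Fin r → ℕ) × RatFn (Vars k)

/-- The star product of a list of functions; the empty product is the constant `1` of degree `0`,
which is the unit of the star multiplication on symmetric functions. -/
def starProd {r : ℕ} : List (GradedFn r) → GradedFn r
  | [] => ⟨0, 1⟩
  | x :: L => ⟨x.1 + (starProd L).1, star x.2 (starProd L).2⟩

/-! ### Differential forms of the discriminantal arrangement -/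

/-- Coefficient vectors of the linear forms `t_a` and `t_a - t_b` (`a ≠ b`) that define the
hyperplanes of the discriminantal arrangement. -/
def discriminantalForms (σ : Type) [DecidableEq σ] : Set (σ → ℂ) :=
  {c | (∃ a, c = Pi.single a 1) ∨ ∃ a b, a ≠ b ∧ c = Pi.single a 1 - Pi.single b 1}

/-- The linear form `∑ₐ c_a t_a`. -/
def linForm {σ : Type} [Fintype σ] (c : σ → ℂ) : RatFn σ := ∑ a, c a • tvar a

/-- The top degree part of the algebra generated by the logarithmic forms `df_H / f_H` of the
discriminantal arrangement, a form being written as `R dV` and represented by `R`.  It is spanned by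
the wedge products of `|σ|` of the generators, and
`⋀_u (df_u / f_u) = (det (∂f_u / ∂t_a) / ∏_u f_u) dV`. -/
def topLogForms (σ : Type) [Fintype σ] [DecidableEq σ] : Submodule ℂ (RatFn σ) :=
  Submodule.span ℂ {R | ∃ f : σ → (σ → ℂ), (∀ u, f u ∈ discriminantalForms σ) ∧
    R = (Matrix.of f).det • (∏ u, linForm (f u))⁻¹}

lemma ratRename_smul {σ τ : Type} (e : σ → τ) (he : Function.Injective e) (c : ℂ) (R : RatFn σ) :
    ratRename e he (c • R) = c • ratRename e he R := by
  have h : ratRename e he (algebraMap ℂ (RatFn σ) c) = algebraMap ℂ (RatFn τ) c := by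
    rw [IsScalarTower.algebraMap_apply ℂ (MvPolynomial σ ℂ) (RatFn σ),
      IsScalarTower.algebraMap_apply ℂ (MvPolynomial τ ℂ) (RatFn τ)]
    simp [ratRename, IsFractionRing.map, IsLocalization.map_eq]
  rw [Algebra.smul_def, map_mul, h, ← Algebra.smul_def]

/-- The space `𝒜^{G_k}` of skew-invariant top degree logarithmic forms `R dV_k`, represented by `R`.
As `π · dV_k = sgn(π) dV_k`, the form `R dV_k` is skew-invariant iff `R` is symmetric. -/
def skewForms {r : ℕ} (k : Fin r → ℕ) : Submodule ℂ (RatFn (Vars k)) where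
  carrier := {R | R ∈ topLogForms (Vars k) ∧ IsSymm R}
  zero_mem' := ⟨Submodule.zero_mem _, fun π => map_zero _⟩
  add_mem' := fun hR hS => ⟨Submodule.add_mem _ hR.1 hS.1, fun π => by
    rw [map_add, hR.2 π, hS.2 π]⟩
  smul_mem' := fun c R hR => ⟨Submodule.smul_mem _ c hR.1, fun π => by
    have h := hR.2 π
    rw [permute, ratRename_smul, ← permute, h]⟩

/-! ### The free algebra, flags and the canonical differential form -/

/-- The multi-indices `J : {1, …, |k|} → {1, …, r}` with `#J⁻¹(i) = k_i`. -/
def IsMultiIndex {r : ℕ} (k : Fin r → ℕ) (J : Fin (∑ i, k i) → Fin r) : Prop :=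
  ∀ i, (Finset.univ.filter fun u => J u = i).card = k i

/-- The monomial `f̃_J = f̃_{J(n)} ⋯ f̃_{J(2)} f̃_{J(1)}`. -/
def word {r n : ℕ} (J : Fin n → Fin r) : FreeAlgebra ℂ (Fin r) :=
  ((List.ofFn fun u => FreeAlgebra.ι ℂ (J u)).reverse).prod

/-- The homogeneous part `U_r[k]` of the free algebra on `f̃_1, …, f̃_r`. -/
def freePart {r : ℕ} (k : Fin r → ℕ) : Submodule ℂ (FreeAlgebra ℂ (Fin r)) :=
  Submodule.span ℂ {x | ∃ J : Fin (∑ i, k i) → Fin r, IsMultiIndex k J ∧ x = word J}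

/-- The sign of an enumeration `e` of the variables relative to the standard one,
`t^{(1)}_1, …, t^{(1)}_{k_1}, t^{(2)}_1, …`; so `dt_{e 0} ∧ dt_{e 1} ∧ ⋯ = sgn(e) dV_k`. -/
def enumSign {r : ℕ} {k : Fin r → ℕ} (e : Fin (∑ i, k i) ≃ Vars k) : ℂ :=
  ((Equiv.Perm.sign (e.trans finSigmaFinEquiv) : ℤˣ) : ℤ)

/-- The residue of the form `R dV_k` with respect to the flag
`F_e = [(t_{e 0} = 0) ⊃ (t_{e 0} = t_{e 1} = 0) ⊃ ⋯]`. -/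
def flagRes {r : ℕ} {k : Fin r → ℕ} (e : Fin (∑ i, k i) ≃ Vars k) :
    RatFn (Vars k) →ₗ[ℂ] RatFn (Vars k) :=
  enumSign e • iterRes e

open scoped Classical in
/-- The residue of `R dV_k` with respect to the skew-invariant combination of flags that corresponds
to `f̃_J`, namely `(sgn(J) / ∏ᵢ k_i!) Asym_k^J (F)`.  The flags in the `G_k`-orbit of the flag `F`
of `J` are the `F_e` for the enumerations `e` whose upper indices are given by `J`, and `F_e` occurs
in `sgn(J) Asym_k^J (F)` with coefficient `sgn(e)`. -/
def wordRes {r : ℕ} {k : Fin r → ℕ} (J : Fin (∑ i, k i) → Fin r) :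
    RatFn (Vars k) →ₗ[ℂ] RatFn (Vars k) :=
  (∏ i, ((k i).factorial : ℂ))⁻¹ •
    ∑ e ∈ Finset.univ.filter (fun e : Fin (∑ i, k i) ≃ Vars k => ∀ u, (e u).1 = J u),
      enumSign e • flagRes e

/-- `Ω` is the canonical element of `𝒜^{G_k} ⊗ U_r[k]` for the residue pairing between `𝒜^{G_k}` and
`U_r[k]`: contracting its first factor with `x ∈ U_r[k]` gives back `x`, for `x = f̃_J`, which span
`U_r[k]`. -/
def IsCanonicalForm {r : ℕ} (k : Fin r → ℕ) (Ω : skewForms k ⊗[ℂ] freePart k) : Prop :=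
  ∀ J : Fin (∑ i, k i) → Fin r, IsMultiIndex k J →
    TensorProduct.map (wordRes J ∘ₗ (skewForms k).subtype) (freePart k).subtype Ω =
      (1 : RatFn (Vars k)) ⊗ₜ[ℂ] word J

/-! ### The nilpotent subalgebra, PBW monomials and the form of a simple Lie algebra -/

section LieAlg

variable {L : Type*} [LieRing L] [LieAlgebra ℂ L] [FiniteDimensional ℂ L]
  [LieAlgebra.IsKilling ℂ L] {H : LieSubalgebra ℂ L} [H.IsCartanSubalgebra]

/-- The sum of the root spaces of the negative roots. -/
def negRootSum (b : (LieAlgebra.IsKilling.rootSystem H).Base) : LieSubmodule ℂ H L :=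
  ⨆ β : {β : H.root // b.IsPos β}, LieAlgebra.rootSpace H (-(β.1.1 : H → ℂ))

lemma lie_mem_negRootSum (b : (LieAlgebra.IsKilling.rootSystem H).Base) {x y : L}
    (hx : x ∈ negRootSum b) (hy : y ∈ negRootSum b) : ⁅x, y⁆ ∈ negRootSum b := by
  induction hx using LieSubmodule.iSup_induction' with
  | zero => simp
  | add _ _ _ _ hu hv => rw [add_lie]; exact add_mem hu hv
  | mem β u hu =>
    induction hy using LieSubmodule.iSup_induction' with
    | zero => simp
    | add _ _ _ _ hv hw => rw [lie_add]; exact add_mem hv hw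
    | mem γ v hv =>
      have huv := LieAlgebra.lie_mem_genWeightSpace_of_mem_genWeightSpace hu hv
      by_cases h0 : ⁅u, v⁆ = 0
      · rw [h0]; exact zero_mem _
      have hne : LieModule.genWeightSpace L (-(β.1.1 : H → ℂ) + -(γ.1.1 : H → ℂ)) ≠ ⊥ := by
        intro hbot
        rw [hbot] at huv
        exact h0 ((LieSubmodule.mem_bot _).mp huv)
      let δ : LieModule.Weight ℂ H L := ⟨_, hne⟩
      have hδ : (δ : H → ℂ) = -(β.1.1 : H → ℂ) + -(γ.1.1 : H → ℂ) := rfl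
      by_cases hz : δ.IsZero
      · exfalso
        let _ := (LieAlgebra.IsKilling.rootSystem H).indexNeg
        have hγ : γ.1 = -β.1 := by
          apply (LieAlgebra.IsKilling.rootSystem H).root.injective
          rw [RootPairing.indexNeg_neg, RootPairing.root_reflectionPerm,
            RootPairing.reflection_apply_self]
          ext x
          have h1 := congrFun (hδ.symm.trans hz) x
          simp only [Pi.add_apply, Pi.neg_apply, Pi.zero_apply] at h1
          simp only [LieAlgebra.IsKilling.rootSystem_root_apply, LinearMap.neg_apply,
            LieModule.Weight.toLinear_apply]
          linear_combination -h1
        have hp := γ.2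
        rw [hγ] at hp
        exact (RootPairing.Base.IsPos.neg_iff_not b β.1).mp hp β.2
      · have hnz : (-δ).IsNonZero := LieModule.Weight.isNonZero_neg.mpr hz
        let ε : H.root := ⟨-δ, by simpa using hnz⟩
        have hε : b.IsPos ε := by
          refine RootPairing.Base.IsPos.add β.2 γ.2 ?_
          ext x
          simp [ε, hδ]
          ring
        refine LieSubmodule.mem_iSup_of_mem (⟨ε, hε⟩ : {β : H.root // b.IsPos β}) ?_
        have : (-(ε.1 : H → ℂ)) = -(β.1.1 : H → ℂ) + -(γ.1.1 : H → ℂ) := by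
          simp only [ε, LieModule.Weight.coe_neg, neg_neg, hδ]
        rw [this]
        exact huv

/-- The Lie subalgebra `𝔫 = ⨁_β 𝔫_β`, where `𝔫_β` is the root space of `-β` for `β` positive. -/
def nilSubalgebra (b : (LieAlgebra.IsKilling.rootSystem H).Base) : LieSubalgebra ℂ L where
  __ := (negRootSum b).toSubmodule
  lie_mem' := lie_mem_negRootSum b

/-- `𝔫_β`, for a positive root `β`. -/
def negRootSpace (b : (LieAlgebra.IsKilling.rootSystem H).Base) (β : H.root) :
    Submodule ℂ (nilSubalgebra b) :=
  (LieAlgebra.rootSpace H (-(β.1 : H → ℂ))).toSubmodule.comap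
    (nilSubalgebra b).toSubmodule.subtype

end LieAlg

section Enveloping

variable {N : Type*} [LieRing N] [LieAlgebra ℂ N]

/-- The map `q : U_r → U(𝔫)` with `f̃_i ↦ f_i`. -/
def quotMap {r : ℕ} (f : Fin r → N) :
    FreeAlgebra ℂ (Fin r) →ₐ[ℂ] UniversalEnvelopingAlgebra ℂ N :=
  FreeAlgebra.lift ℂ fun i => UniversalEnvelopingAlgebra.ι ℂ (f i)

/-- `x ∈ U(𝔫)` has content `k`. -/
def HasContent {r : ℕ} (f : Fin r → N) (x : UniversalEnvelopingAlgebra ℂ N) (k : Fin r → ℕ) :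
    Prop :=
  x ∈ (freePart k).map (quotMap f).toLinearMap

/-- The monomial `F_1^{p_1} F_2^{p_2} ⋯ F_m^{p_m}` in `U(𝔫)`. -/
def pbwMonomial {m : ℕ} (F : Fin m → N) (p : Fin m → ℕ) : UniversalEnvelopingAlgebra ℂ N :=
  (List.ofFn fun l => UniversalEnvelopingAlgebra.ι ℂ (F l) ^ p l).prod

/-- The image of `Ω` under `id ⊗ q : 𝒜^{G_k} ⊗ U_r[k] → 𝒜^{G_k} ⊗ U(𝔫)`. -/
def lieForm {r : ℕ} (f : Fin r → N) {k : Fin r → ℕ} (Ω : skewForms k ⊗[ℂ] freePart k) :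
    skewForms k ⊗[ℂ] UniversalEnvelopingAlgebra ℂ N :=
  TensorProduct.map LinearMap.id ((quotMap f).toLinearMap ∘ₗ (freePart k).subtype) Ω

/-- The `ω_p` are the coefficients of `Ω^𝔤` in
`Ω^𝔤 = ∑_p ω_p dV_k ⊗ F_1^{p_1} ⋯ F_m^{p_m}`, where the sum is over the `p` such that
`F_1^{p_1} ⋯ F_m^{p_m}` has content `k`. -/
def IsPBWExpansion {r m : ℕ} (f : Fin r → N) (F : Fin m → N) {k : Fin r → ℕ}
    (Ωg : skewForms k ⊗[ℂ] UniversalEnvelopingAlgebra ℂ N)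
    (ω : (Fin m → ℕ) →₀ skewForms k) : Prop :=
  (∀ p ∈ ω.support, HasContent f (pbwMonomial F p) k) ∧
    Ωg = ω.sum fun p R => R ⊗ₜ[ℂ] pbwMonomial F p

end Enveloping

/-- Multiplication of a function by a scalar, in the same degree. -/
def scale {r : ℕ} (c : ℂ) (x : GradedFn r) : GradedFn r := ⟨x.1, c • x.2⟩

/-- `η_1 * ⋯ * η_1 * η_2 * ⋯ * η_2 * ⋯ * η_m * ⋯ * η_m` with `p_l` factors `η_l`. -/
def starMonomial {r m : ℕ} {κ : Fin m → Fin r → ℕ} (η : (l : Fin m) → RatFn (Vars (κ l)))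
    (p : Fin m → ℕ) : GradedFn r :=
  starProd (List.ofFn fun l => List.replicate (p l) (⟨κ l, η l⟩ : GradedFn r)).flatten

end CanonicalForm

end

noncomputable section

namespace CanonicalForm

/-! ### Chains and their iterated residues -/

section Chains

variable {σ τ : Type}

/-! For an enumeration `w` of all variables, the chain `1 / (t_{w 0} (t_{w 1} - t_{w 0}) ⋯)` has
iterated residue `1` along the flag of `w` and `0` along every other flag (`listRes_chain`). Chains
also span the logarithmic forms of top degree (`topLogForms_le_span_chain`): the linear forms in a
nonzero generator are the edges of a tree whose vertices are the variables and `0`, and this tree is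
dismantled leaf by leaf, each leaf being shuffled into a chain by partial fractions. So chains are a
basis dual to the flags. Taking invariants, symmetric forms are the `formOf k g`, with `g` a
function on words whose value at `J` is the residue at `f̃_J` (`exists_eq_formOf`,
`wordRes_formOf`). Thus `𝒜^{G_k}` is the dual of `U_r[k]`, the canonical element exists and is
unique, and `ω_p` is the form whose function sends a word in the `f_i` to its coordinate at the
ordered monomial `F^p` (`IsPBWExpansion.apply_eq`).

The formula thereby becomes a statement about functionals on `U(𝔫)`. The residue of a star product
at a word is a sum over the splittings of that word into two complementary subwords, and the
coproduct of `U(𝔫)` splits words in the same way, so star products of forms are convolutions of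
functionals (`star_formOf_wordValue`). The `F_l` are primitive, so the coproduct of `F^q` is
binomial, and the coordinate of `F_l` convolved with that of `F^p` is `p_l + 1` times that of `F^{p
+ e_l}` (`convolution_coord`). Iteration produces the factor `∏ p_l!` (`starProd_map_coord`), with
`η_l` the form of the coordinate of `F_l`.

Two facts about `U(𝔫)` are needed. The ordered monomials form a basis: they span by reordering, and
iterated convolutions show that they are independent as soon as the `F_l` are, which is verified in
`U(𝔤)` because `ad` is faithful. Contents are detected by commutators with the Cartan subalgebra in
`U(𝔤)`, since the simple roots are independent; root vectors have a content because they are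
iterated brackets of the `f_i`. -/

/-- The variable `t_a` for `x = some a`, and `0` for `x = none`. -/
def point (x : Option σ) : RatFn σ := x.elim 0 tvar

@[simp] lemma point_none : point (none : Option σ) = 0 := rfl

@[simp] lemma point_some (a : σ) : point (some a) = tvar a := rfl

lemma tvar_injective : Function.Injective (tvar : σ → RatFn σ) := fun _ _ h =>
  MvPolynomial.X_injective (IsFractionRing.injective (MvPolynomial σ ℂ) (RatFn σ) h)

lemma tvar_ne_zero (a : σ) : tvar a ≠ 0 := by
  intro h
  have : (MvPolynomial.X a : MvPolynomial σ ℂ) = 0 :=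
    IsFractionRing.injective (MvPolynomial σ ℂ) (RatFn σ) (h.trans (map_zero _).symm)
  exact MvPolynomial.X_ne_zero a this

lemma point_injective : Function.Injective (point : Option σ → RatFn σ) := by
  rintro (_ | a) (_ | b) h
  · rfl
  · exact absurd h.symm (tvar_ne_zero b)
  · exact absurd h (tvar_ne_zero a)
  · exact congrArg some (tvar_injective h)

/-- The rational function `1 / ((t_{w 0} - t_x) (t_{w 1} - t_{w 0}) ⋯)`. -/
def chainFrom : Option σ → List σ → RatFn σ
  | _, [] => 1
  | x, a :: w => (tvar a - point x)⁻¹ * chainFrom (some a) w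

/-- The rational function `1 / (t_{w 0} (t_{w 1} - t_{w 0}) ⋯)`. -/
abbrev chain (w : List σ) : RatFn σ := chainFrom none w

lemma ratRename_tvar (e : σ → τ) (he : Function.Injective e) (a : σ) :
    ratRename e he (tvar a) = tvar (e a) := by
  simp [ratRename, tvar, IsFractionRing.map, IsLocalization.map_eq]

lemma ratRename_chainFrom (e : σ → τ) (he : Function.Injective e) (x : Option σ) (w : List σ) :
    ratRename e he (chainFrom x w) = chainFrom (x.map e) (w.map e) := by
  induction w generalizing x with
  | nil => simp [chainFrom]
  | cons a w ih => cases x <;> simp [chainFrom, ih, ratRename_tvar]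

variable [DecidableEq σ]

/-- `R` is regular along `t_b = 0`, with restriction `v`. -/
def RegularAt (b : σ) (R v : RatFn σ) : Prop :=
  ∃ P : PowerSeries (RatFn σ), laurentAt b R = HahnSeries.ofPowerSeries ℤ _ P ∧
    PowerSeries.constantCoeff P = v

namespace RegularAt

variable {b : σ} {R S v w : RatFn σ}

lemma one : RegularAt b (1 : RatFn σ) 1 := ⟨1, by simp, by simp⟩

lemma mul (hR : RegularAt b R v) (hS : RegularAt b S w) : RegularAt b (R * S) (v * w) := by
  obtain ⟨P, hP, rfl⟩ := hR
  obtain ⟨Q, hQ, rfl⟩ := hS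
  exact ⟨P * Q, by rw [map_mul, map_mul, hP, hQ], map_mul _ _ _⟩

lemma sub (hR : RegularAt b R v) (hS : RegularAt b S w) : RegularAt b (R - S) (v - w) := by
  obtain ⟨P, hP, rfl⟩ := hR
  obtain ⟨Q, hQ, rfl⟩ := hS
  exact ⟨P - Q, by rw [map_sub, map_sub, hP, hQ], map_sub _ _ _⟩

lemma inv (hR : RegularAt b R v) (hv : v ≠ 0) : RegularAt b R⁻¹ v⁻¹ := by
  obtain ⟨P, hP, rfl⟩ := hR
  refine ⟨P⁻¹, ?_, PowerSeries.constantCoeff_inv P⟩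
  rw [map_inv₀, hP]
  refine inv_eq_of_mul_eq_one_right ?_
  rw [← map_mul, PowerSeries.mul_inv_cancel _ hv, map_one]

lemma resAt_eq_zero (hR : RegularAt b R v) : resAt b R = 0 := by
  obtain ⟨P, hP, rfl⟩ := hR
  change (laurentAt b R).coeff (-1) = 0
  rw [hP]
  simp [PowerSeries.coeff_coe]

end RegularAt

lemma laurentAt_tvar (a b : σ) : laurentAt b (tvar a) =
    HahnSeries.ofPowerSeries ℤ _ (if a = b then PowerSeries.X else PowerSeries.C (tvar a)) := by
  rw [laurentAt, tvar, IsFractionRing.lift_algebraMap]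
  simp only [polyLaurent, RingHom.comp_apply, AlgHom.toRingHom_eq_coe, RingHom.coe_coe, polyAt,
    MvPolynomial.aeval_X]
  split_ifs <;> simp [tvar]

/-- The specialization `t_b = 0`. -/
def specialize (b : σ) (x : Option σ) : Option σ := if x = some b then none else x

lemma regularAt_point (b : σ) (x : Option σ) :
    RegularAt b (point x) (point (specialize b x)) := by
  rcases x with _ | a
  · exact ⟨0, by simp, by simp [specialize]⟩
  · refine ⟨_, laurentAt_tvar a b, ?_⟩
    by_cases h : a = b <;> simp [h, specialize]

lemma resAt_inv_mul {b : σ} {R v : RatFn σ} (hR : RegularAt b R v) :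
    resAt b ((tvar b)⁻¹ * R) = v := by
  obtain ⟨P, hP, rfl⟩ := hR
  change (laurentAt b ((tvar b)⁻¹ * R)).coeff (-1) = _
  rw [map_mul, map_inv₀, laurentAt_tvar, if_pos rfl, hP, HahnSeries.ofPowerSeries_X]
  have : (HahnSeries.single (1 : ℤ) (1 : RatFn σ))⁻¹ = HahnSeries.single (-1) 1 := by
    refine inv_eq_of_mul_eq_one_right ?_
    simp
  rw [this]
  have h := HahnSeries.coeff_single_mul_add (r := (1 : RatFn σ)) (x := HahnSeries.ofPowerSeries ℤ _ P)
    (a := (0 : ℤ)) (b := (-1 : ℤ))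
  rw [zero_add] at h
  rw [h, one_mul]
  simpa using LaurentSeries.coeff_coe_powerSeries P 0

/-- Setting `t_b = 0` can only move the starting point to `0`; no denominator vanishes, because the
points met remain distinct. -/
lemma regularAt_chainFrom_of_notMem {b : σ} (x : Option σ) (w : List σ) (hb : b ∉ w)
    (hw : w.Nodup) (hx : ∀ a ∈ w, x ≠ some a) :
    RegularAt b (chainFrom x w) (chainFrom (specialize b x) w) := by
  induction w generalizing x with
  | nil => exact RegularAt.one
  | cons a w ih =>
    simp only [List.mem_cons, not_or, List.nodup_cons] at hb hw
    have ha : specialize b (some a) = some a := by simp [specialize, Ne.symm hb.1]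
    have h1 := (regularAt_point b (some a)).sub (regularAt_point b x)
    have h2 := ih (some a) hb.2 hw.2 fun c hc h => hw.1 (Option.some_injective _ h ▸ hc)
    rw [ha] at h1 h2
    refine (h1.inv ?_).mul h2
    rw [sub_ne_zero]
    refine point_injective.ne ?_
    have := hx a List.mem_cons_self
    by_cases h : x = some b <;> simp [specialize, h, Ne.symm this]

/-- The only possible pole along `t_b = 0` is the factor `t_b` itself, which occurs only when a
chain starting at `0` has head `b`. -/
lemma regularAt_chainFrom {b : σ} (x : Option σ) (w : List σ)
    (hw : w.Nodup) (hx : ∀ a ∈ w, x ≠ some a) (hxb : x = none → w.head? ≠ some b) :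
    ∃ v, RegularAt b (chainFrom x w) v := by
  induction w generalizing x with
  | nil => exact ⟨1, RegularAt.one⟩
  | cons a w ih =>
    simp only [List.nodup_cons] at hw
    have h1 := (regularAt_point b (some a)).sub (regularAt_point b x)
    obtain ⟨v, h2⟩ := ih (some a) hw.2 (fun c hc h => hw.1 (Option.some_injective _ h ▸ hc))
      (by simp)
    refine ⟨_, (h1.inv ?_).mul h2⟩
    rw [sub_ne_zero]
    refine point_injective.ne ?_
    have := hx a List.mem_cons_self
    rcases x with _ | c
    · have : a ≠ b := by simpa using hxb rfl
      simp [specialize, this]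
    · have hca : c ≠ a := fun h => this (congrArg some h)
      by_cases h : a = b
      · subst h; simp [specialize, hca]
      · by_cases h' : c = b <;> simp [specialize, h, h', Ne.symm hca]

/-- Once the factor `t_b` is removed, `u` hangs from `t_b`; at `t_b = 0` it hangs from `0` and is a
chain again. -/
lemma resAt_chain_mul_chain_of_head {b : σ} (u v : List σ) (hu : (b :: u).Nodup) (hv : v.Nodup)
    (hbv : b ∉ v) : resAt b (chain (b :: u) * chain v) = chain u * chain v := by
  simp only [List.nodup_cons] at hu
  rw [chain, chainFrom, point_none, sub_zero, mul_assoc]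
  apply resAt_inv_mul
  have h1 := regularAt_chainFrom_of_notMem (some b) u hu.1 hu.2
    fun c hc h => hu.1 (Option.some_injective _ h ▸ hc)
  have h2 := regularAt_chainFrom_of_notMem none v hbv hv (by simp)
  simpa [specialize] using h1.mul h2

lemma resAt_chain_mul_chain_of_ne {b : σ} (u v : List σ) (hu : u.Nodup) (hv : v.Nodup)
    (hbu : u.head? ≠ some b) (hbv : v.head? ≠ some b) :
    resAt b (chain u * chain v) = 0 := by
  obtain ⟨_, h1⟩ := regularAt_chainFrom none u hu (by simp) fun _ => hbu
  obtain ⟨_, h2⟩ := regularAt_chainFrom none v hv (by simp) fun _ => hbv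
  exact (h1.mul h2).resAt_eq_zero

/-- The residue along `t_{w 0} = 0`, followed by the one along `t_{w 1} = 0`, and so on. -/
def listRes (w : List σ) : RatFn σ →ₗ[ℂ] RatFn σ :=
  w.foldl (fun φ a => resAt a ∘ₗ φ) LinearMap.id

lemma listRes_cons (a : σ) (w : List σ) (R : RatFn σ) :
    listRes (a :: w) R = listRes w (resAt a R) := by
  have h : ∀ (w : List σ) (φ : RatFn σ →ₗ[ℂ] RatFn σ) (R : RatFn σ),
      w.foldl (fun φ a => resAt a ∘ₗ φ) φ R = listRes w (φ R) := by
    intro w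
    induction w with
    | nil => intro φ R; rfl
    | cons a w ih =>
      intro φ R
      rw [List.foldl_cons, ih]
      exact (ih (resAt a ∘ₗ LinearMap.id) (φ R)).symm
  rw [listRes, List.foldl_cons, h]
  rfl

lemma iterRes_eq_listRes {n : ℕ} (e : Fin n ≃ σ) : iterRes e = listRes (List.ofFn e) := rfl

/-- Each residue strips a head from the chain that contains the variable, or gives zero. The result
is `1` exactly when `w` is a shuffle of `u` and `v`; `p` records which chain a variable belongs to.
-/
lemma listRes_chain_mul_chain (p : σ → Bool) (w u v : List σ) (hu : u.Nodup) (hv : v.Nodup)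
    (hpu : ∀ a ∈ u, p a = true) (hpv : ∀ a ∈ v, p a = false)
    (hlen : u.length + v.length = w.length) :
    listRes w (chain u * chain v) =
      if w.filter p = u ∧ w.filter (fun a => !p a) = v then 1 else 0 := by
  induction w generalizing u v with
  | nil =>
    simp only [List.length_nil, Nat.add_eq_zero_iff, List.length_eq_zero_iff] at hlen
    obtain ⟨rfl, rfl⟩ := hlen
    simp [listRes, chainFrom]
  | cons b w ih =>
    rw [listRes_cons]
    by_cases hb : p b = true
    · have hbv : b ∉ v := fun h => by simp [hpv b h] at hb
      by_cases h : u.head? = some b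
      · obtain ⟨u', rfl⟩ : ∃ u', u = b :: u' := by
          cases u <;> simp_all
        rw [resAt_chain_mul_chain_of_head u' v hu hv hbv,
          ih u' v (List.nodup_cons.mp hu).2 hv (fun a ha => hpu a (List.mem_cons_of_mem _ ha)) hpv
          (by simp only [List.length_cons] at hlen; omega)]
        simp [hb]
      · rw [resAt_chain_mul_chain_of_ne u v hu hv h fun h' => hbv (List.mem_of_head? h'), map_zero,
          if_neg]
        rintro ⟨rfl, -⟩
        simp [hb] at h
    · simp only [Bool.not_eq_true] at hb
      have hbu : b ∉ u := fun h => by simp [hpu b h] at hb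
      by_cases h : v.head? = some b
      · obtain ⟨v', rfl⟩ : ∃ v', v = b :: v' := by
          cases v <;> simp_all
        rw [mul_comm, resAt_chain_mul_chain_of_head v' u hv hu hbu, mul_comm,
          ih u v' hu (List.nodup_cons.mp hv).2 hpu (fun a ha => hpv a (List.mem_cons_of_mem _ ha))
          (by simp only [List.length_cons] at hlen; omega)]
        simp [hb]
      · rw [resAt_chain_mul_chain_of_ne u v hu hv (fun h' => hbu (List.mem_of_head? h')) h, map_zero,
          if_neg]
        rintro ⟨-, rfl⟩
        simp [hb] at h

lemma listRes_chain (w u : List σ) (hu : u.Nodup) (hlen : u.length = w.length) :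
    listRes w (chain u) = if w = u then 1 else 0 := by
  have h := listRes_chain_mul_chain (fun _ => true) w u [] hu List.nodup_nil (by simp) (by simp)
    (by simpa using hlen)
  simpa [chainFrom] using h

/-! ### Shuffles of chains -/

omit [DecidableEq σ] in
-- Partial fractions: two edges leaving `x` are rewritten as two paths, one through `a` first and
-- one through `b` first.
lemma inv_sub_mul_inv_sub {K : Type*} [Field K] {x a b : K} (hab : a ≠ b) (ha : a ≠ x)
    (hb : b ≠ x) :
    (a - x)⁻¹ * (b - x)⁻¹ = (a - x)⁻¹ * (b - a)⁻¹ + (b - x)⁻¹ * (a - b)⁻¹ := by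
  have h1 : a - x ≠ 0 := sub_ne_zero.mpr ha
  have h2 : b - x ≠ 0 := sub_ne_zero.mpr hb
  have h3 : b - a ≠ 0 := sub_ne_zero.mpr hab.symm
  rw [← neg_sub b a, inv_neg]
  field_simp
  ring

omit [DecidableEq σ] in
lemma chainFrom_cons_mem_span {x : Option σ} {a : σ} {w w' : List σ} {R : RatFn σ}
    (hw' : (a :: w').Perm w)
    (hR : R ∈ Submodule.span ℂ {S | ∃ u, u.Perm w' ∧ S = chainFrom (some a) u}) :
    (tvar a - point x)⁻¹ * R ∈ Submodule.span ℂ {S | ∃ u, u.Perm w ∧ S = chainFrom x u} := by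
  induction hR using Submodule.span_induction with
  | mem R h =>
    obtain ⟨u, hu, rfl⟩ := h
    exact Submodule.subset_span ⟨a :: u, (hu.cons a).trans hw', rfl⟩
  | zero => simp
  | add R S _ _ hR hS => rw [mul_add]; exact add_mem hR hS
  | smul c R _ hR => rw [mul_smul_comm]; exact Submodule.smul_mem _ _ hR

omit [DecidableEq σ] in
-- Partial fractions on the two first factors decide which head comes first; recursion then produces
-- the shuffles of `u` and `v`.
lemma chainFrom_mul_chainFrom_mem_span (x : Option σ) (u v : List σ)
    (h : (u ++ v).Nodup) (hx : ∀ a ∈ u ++ v, x ≠ some a) :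
    chainFrom x u * chainFrom x v ∈
      Submodule.span ℂ {S | ∃ w, w.Perm (u ++ v) ∧ S = chainFrom x w} := by
  induction hn : u.length + v.length generalizing x u v with
  | zero =>
    simp only [Nat.add_eq_zero_iff, List.length_eq_zero_iff] at hn
    obtain ⟨rfl, rfl⟩ := hn
    exact Submodule.subset_span ⟨[], by simp, by simp [chainFrom]⟩
  | succ n ih =>
    rcases u with _ | ⟨a, u⟩
    · exact Submodule.subset_span ⟨v, by simp, by simp [chainFrom]⟩
    rcases v with _ | ⟨b, v⟩
    · exact Submodule.subset_span ⟨a :: u, by simp, by simp [chainFrom]⟩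
    have hab : a ≠ b := by
      rintro rfl
      simp at h
    have key : chainFrom x (a :: u) * chainFrom x (b :: v) =
        (tvar a - point x)⁻¹ * (chainFrom (some a) u * chainFrom (some a) (b :: v)) +
        (tvar b - point x)⁻¹ * (chainFrom (some b) (a :: u) * chainFrom (some b) v) := by
      simp only [chainFrom, point_some]
      linear_combination chainFrom (some a) u * chainFrom (some b) v *
        inv_sub_mul_inv_sub (tvar_injective.ne hab)
          (point_injective.ne (a₁ := some a) (hx a (by simp)).symm)
          (point_injective.ne (a₁ := some b) (hx b (by simp)).symm)
    rw [key]
    have hp : (b :: (a :: u ++ v)).Perm (a :: u ++ b :: v) := List.perm_middle.symm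
    have h' := hp.nodup_iff.mpr h
    refine add_mem (chainFrom_cons_mem_span (w' := u ++ b :: v) (by simp) ?_)
      (chainFrom_cons_mem_span hp ?_)
    · rw [List.cons_append, List.nodup_cons] at h
      refine ih (some a) u (b :: v) h.2 (fun c hc hac => ?_) (by simp at hn ⊢; omega)
      exact h.1 (Option.some_injective _ hac ▸ hc)
    · rw [List.nodup_cons] at h'
      refine ih (some b) (a :: u) v h'.2 (fun c hc hac => ?_) (by simp at hn ⊢; omega)
      exact h'.1 (Option.some_injective _ hac ▸ hc)

omit [DecidableEq σ] in
-- Attaching a leaf `a` at the vertex `x` of a chain: the part up to `x` is kept, and the part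
-- beyond `x` is shuffled with the one-term chain of `a`.
lemma inv_sub_mul_chainFrom_mem_span (x y : Option σ) (a : σ) (w : List σ)
    (h : (a :: w).Nodup) (hy : ∀ c ∈ a :: w, y ≠ some c) (hx : x = y ∨ ∃ b ∈ w, x = some b) :
    (tvar a - point x)⁻¹ * chainFrom y w ∈
      Submodule.span ℂ {S | ∃ u, u.Perm (a :: w) ∧ S = chainFrom y u} := by
  induction w generalizing y with
  | nil =>
    obtain rfl : x = y := by simpa using hx
    exact Submodule.subset_span ⟨[a], by simp, rfl⟩
  | cons b w ih =>
    by_cases hxy : x = y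
    · subst hxy
      simpa [chainFrom] using chainFrom_mul_chainFrom_mem_span x [a] (b :: w) h hy
    · rw [chainFrom, mul_left_comm]
      refine chainFrom_cons_mem_span (List.Perm.swap _ _ _) (ih (some b) ?_ ?_ ?_)
      · exact h.sublist (by simp)
      · intro c hc hbc
        obtain rfl := Option.some_injective _ hbc
        simp only [List.nodup_cons, List.mem_cons] at h hc
        rcases hc with rfl | hc
        · exact h.1 (Or.inl rfl)
        · exact h.2.1 hc
      · obtain ⟨c, hc, rfl⟩ := hx.resolve_left hxy
        rcases List.mem_cons.mp hc with rfl | hc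
        · exact Or.inl rfl
        · exact Or.inr ⟨c, hc, rfl⟩

end Chains

/-! ### Logarithmic forms of top degree are spanned by chains -/

section TopForms

variable {σ : Type} [Fintype σ] [DecidableEq σ]

lemma linForm_single (a : σ) : linForm (Pi.single a 1) = tvar a := by
  simp [linForm, Pi.single_apply, ite_smul]

omit [DecidableEq σ] in
lemma linForm_sub (c d : σ → ℂ) : linForm (c - d) = linForm c - linForm d := by
  simp [linForm, sub_smul]

omit [Fintype σ] [DecidableEq σ] in
lemma inv_sub_swap {K : Type*} [Field K] (a b : K) : (a - b)⁻¹ = -(b - a)⁻¹ := by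
  rw [← neg_sub, inv_neg]

/-- Up to sign, a form involving `t_a` is an edge from `a` to another vertex `x`, where `none`
stands for the vertex `0`. -/
lemma exists_inv_linForm_eq {c : σ → ℂ} (hc : c ∈ discriminantalForms σ) {a : σ} (ha : c a ≠ 0) :
    ∃ (x : Option σ) (ε : ℂ), x ≠ some a ∧ (∀ b, x = some b → c b ≠ 0) ∧
      (linForm c)⁻¹ = ε • (tvar a - point x)⁻¹ := by
  rcases hc with ⟨b, rfl⟩ | ⟨b, d, hbd, rfl⟩
  · obtain rfl : a = b := by
      by_contra h
      simp [h] at ha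
    exact ⟨none, 1, by simp, by simp, by simp [linForm_single]⟩
  · rw [linForm_sub, linForm_single, linForm_single]
    by_cases hab : a = b
    · subst hab
      refine ⟨some d, 1, by simpa using hbd.symm, fun b hb => ?_, by simp⟩
      obtain rfl := Option.some_injective _ hb
      simp [hbd.symm]
    · obtain rfl : a = d := by
        by_contra h
        simp [h, hab] at ha
      refine ⟨some b, -1, by simpa using hbd, fun d hd => ?_, ?_⟩
      · obtain rfl := Option.some_injective _ hd
        simp [hbd]
      · exact (inv_sub_swap _ _).trans (by simp)

omit [Fintype σ] in
lemma card_support_le {c : σ → ℂ} (hc : c ∈ discriminantalForms σ) (s : Finset σ) :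
    (s.filter fun a => c a ≠ 0).card ≤ 2 := by
  rcases hc with ⟨b, rfl⟩ | ⟨b, d, hbd, rfl⟩
  -- Writing the singleton as `{b, b}` lets `Finset.card_le_two` apply here too.
  · refine (Finset.card_le_card (t := {b, b}) fun a ha => ?_).trans Finset.card_le_two
    by_contra h
    simp_all [Pi.single_apply]
  · refine (Finset.card_le_card (t := {b, d}) fun a ha => ?_).trans Finset.card_le_two
    by_contra h
    simp_all [Pi.single_apply]

/-- Two variables occur only in a difference `t_b - t_d`, whose coefficients cancel. -/
lemma sum_eq_zero_of_card_support_eq_two {c : σ → ℂ} (hc : c ∈ discriminantalForms σ)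
    {s : Finset σ} (h : (s.filter fun a => c a ≠ 0).card = 2) : ∑ a, c a = 0 := by
  rcases hc with ⟨b, rfl⟩ | ⟨b, d, hbd, rfl⟩
  · have : (s.filter fun a => (Pi.single b (1 : ℂ) : σ → ℂ) a ≠ 0).card ≤ 1 := by
      rw [← Finset.card_singleton b]
      refine Finset.card_le_card fun a ha => ?_
      by_contra h
      simp_all [Pi.single_apply]
    omega
  · simp

/-- Double counting. If every variable lay in at least two of the `|s|` forms, each form, having at
most two variables, would have exactly two and so be a difference; then the constant vector would
lie in the common kernel. -/
lemma exists_leaf (s : Finset σ) (hs : s.Nonempty) (T : Finset (σ → ℂ))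
    (hT : ∀ c ∈ T, c ∈ discriminantalForms σ) (hcard : T.card = s.card)
    (hker : ∀ v : σ → ℂ, (∀ c ∈ T, ∑ a, c a * v a = 0) → ∀ a ∈ s, v a = 0) :
    ∃ a ∈ s, ∃ c ∈ T, c a ≠ 0 ∧ ∀ d ∈ T, d a ≠ 0 → d = c := by
  by_contra! hcon
  have h2 : ∀ a ∈ s, 2 ≤ (T.filter fun c => c a ≠ 0).card := by
    intro a ha
    obtain ⟨c, hcT, hca⟩ : ∃ c ∈ T, c a ≠ 0 := by
      by_contra! h
      -- A variable that occurs in no form would give a kernel vector.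
      have := hker (Pi.single a 1) (fun c hc => by simp [Pi.single_apply, h c hc]) a ha
      simp at this
    obtain ⟨d, hdT, hda, hdc⟩ := hcon a ha c hcT hca
    exact Finset.one_lt_card.mpr ⟨c, by simp [hcT, hca], d, by simp [hdT, hda], hdc.symm⟩
  have hcount : ∑ a ∈ s, (T.filter fun c => c a ≠ 0).card =
      ∑ c ∈ T, (s.filter fun a => c a ≠ 0).card :=
    Finset.sum_card_bipartiteAbove_eq_sum_card_bipartiteBelow fun (a : σ) (c : σ → ℂ) => c a ≠ 0
  have hlow := Finset.sum_le_sum h2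
  rw [hcount] at hlow
  have hle : ∀ c ∈ T, (s.filter fun a => c a ≠ 0).card ≤ 2 := fun c hc => card_support_le (hT c hc) s
  have heq : ∑ c ∈ T, (s.filter fun a => c a ≠ 0).card = ∑ c ∈ T, 2 := by
    refine le_antisymm (Finset.sum_le_sum hle) ?_
    simpa [hcard] using hlow
  have h3 := (Finset.sum_eq_sum_iff_of_le hle).mp heq
  obtain ⟨a, ha⟩ := hs
  have := hker (fun _ => 1)
    (fun c hc => by simpa using sum_eq_zero_of_card_support_eq_two (hT c hc) (h3 c hc)) a ha
  simp at this

/-- Induction on the number of variables: a leaf and its only edge are removed, and the leaf is then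
attached to each chain on the remaining variables. -/
lemma prod_inv_linForm_mem_span (s : Finset σ) (T : Finset (σ → ℂ))
    (hT : ∀ c ∈ T, c ∈ discriminantalForms σ) (hs : ∀ c ∈ T, ∀ a ∉ s, c a = 0)
    (hcard : T.card = s.card)
    (hker : ∀ v : σ → ℂ, (∀ c ∈ T, ∑ a, c a * v a = 0) → ∀ a ∈ s, v a = 0) :
    ∏ c ∈ T, (linForm c)⁻¹ ∈
      Submodule.span ℂ {R | ∃ w : List σ, w.Nodup ∧ w.toFinset = s ∧ R = chain w} := by
  induction hn : s.card generalizing s T with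
  | zero =>
    obtain rfl := Finset.card_eq_zero.mp hn
    obtain rfl := Finset.card_eq_zero.mp hcard
    exact Submodule.subset_span ⟨[], by simp, by simp, by simp [chainFrom]⟩
  | succ n ih =>
    obtain ⟨a, ha, c, hc, hca, huniq⟩ := exists_leaf s (Finset.card_pos.mp (by omega)) T hT hcard hker
    have ih' := ih (s.erase a) (T.erase c) (fun d hd => hT d (Finset.mem_of_mem_erase hd)) ?_ ?_ ?_ ?_
    · obtain ⟨x, ε, hxa, hxc, hinv⟩ := exists_inv_linForm_eq (hT c hc) hca
      rw [← Finset.mul_prod_erase _ _ hc, hinv, smul_mul_assoc]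
      refine Submodule.smul_mem _ _ ?_
      generalize ∏ d ∈ T.erase c, (linForm d)⁻¹ = Q at ih'
      induction ih' using Submodule.span_induction with
      | mem R h =>
        obtain ⟨w, hw, hws, rfl⟩ := h
        have haw : a ∉ w := by
          rw [← List.mem_toFinset, hws]
          simp
        refine Submodule.span_mono ?_ (inv_sub_mul_chainFrom_mem_span x none a w
          (List.nodup_cons.mpr ⟨haw, hw⟩) (by simp) ?_)
        · rintro _ ⟨u, hu, rfl⟩
          refine ⟨u, hu.nodup_iff.mpr (List.nodup_cons.mpr ⟨haw, hw⟩), ?_, rfl⟩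
          rw [List.toFinset_eq_of_perm _ _ hu, List.toFinset_cons, hws, Finset.insert_erase ha]
        · rcases x with _ | b
          · exact Or.inl rfl
          · refine Or.inr ⟨b, ?_, rfl⟩
            rw [← List.mem_toFinset, hws, Finset.mem_erase]
            refine ⟨fun h => hxa (congrArg some h), ?_⟩
            by_contra hb
            exact hxc b rfl (hs c hc b hb)
      | zero => simp
      | add R S _ _ hR hS => rw [mul_add]; exact add_mem hR hS
      | smul c R _ hR => rw [mul_smul_comm]; exact Submodule.smul_mem _ _ hR
    · intro d hd b hb
      obtain ⟨hdc, hdT⟩ := Finset.mem_erase.mp hd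
      by_cases hba : b = a
      · subst hba
        by_contra h
        exact hdc (huniq d hdT h)
      · exact hs d hdT b fun h => hb (Finset.mem_erase.mpr ⟨hba, h⟩)
    · rw [Finset.card_erase_of_mem hc, Finset.card_erase_of_mem ha, hcard]
    · intro v hv b hb
      obtain ⟨hba, hbs⟩ := Finset.mem_erase.mp hb
      -- The coordinate at the leaf is adjusted so that `c` vanishes as well; the other forms do not
      -- involve that coordinate.
      let z := (∑ e, c e * v e) / c a
      have hsum : ∀ d : σ → ℂ, ∑ e, d e * (v - Pi.single a z : σ → ℂ) e = ∑ e, d e * v e - d a * z := by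
        intro d
        simp [mul_sub, Finset.sum_sub_distrib, Pi.single_apply]
      have := hker (v - Pi.single a z : σ → ℂ) (fun d hd => ?_) b hbs
      · simpa [hba] using this
      · rw [hsum]
        by_cases hdc : d = c
        · subst hdc
          simp only [z]
          field_simp
          ring
        · have : d a = 0 := by
            by_contra h
            exact hdc (huniq d hd h)
          rw [hv d (Finset.mem_erase.mpr ⟨hdc, hd⟩), this]
          simp
    · rw [Finset.card_erase_of_mem ha, hn]
      rfl

/-- A generator with nonzero determinant has distinct rows with trivial common kernel, which is the
spanning tree condition needed for the leaf induction. -/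
lemma topLogForms_le_span_chain :
    topLogForms σ ≤ Submodule.span ℂ {R | ∃ w : List σ, w.Nodup ∧ (∀ a, a ∈ w) ∧ R = chain w} := by
  rw [topLogForms, Submodule.span_le]
  rintro _ ⟨f, hf, rfl⟩
  by_cases hdet : (Matrix.of f).det = 0
  · rw [hdet, zero_smul]
    exact zero_mem _
  refine Submodule.smul_mem _ _ ?_
  have hinj : Function.Injective f := by
    intro u v huv
    by_contra hne
    exact hdet (Matrix.det_zero_of_row_eq hne huv)
  have hprod : ∏ c ∈ Finset.univ.image f, (linForm c)⁻¹ = (∏ u, linForm (f u))⁻¹ := by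
    rw [Finset.prod_image hinj.injOn, Finset.prod_inv_distrib]
  rw [← hprod]
  refine Submodule.span_mono ?_ (prod_inv_linForm_mem_span Finset.univ _ ?_ (by simp) ?_ ?_)
  · rintro _ ⟨w, hw, hws, rfl⟩
    exact ⟨w, hw, fun a => by rw [← List.mem_toFinset, hws]; simp, rfl⟩
  · simpa using hf
  · exact Finset.card_image_of_injective _ hinj
  · intro v hv a _
    have : (Matrix.of f).mulVec v = 0 := by
      ext u
      simpa [Matrix.mulVec, dotProduct] using hv (f u) (by simp)
    exact congrFun (Matrix.eq_zero_of_mulVec_eq_zero hdet this) a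

/-- Each factor is indexed by its later endpoint. The system is triangular: vanishing at the
starting point propagates along the chain. Values of `f` outside `w` are irrelevant. -/
lemma exists_forms_of_chainFrom (x : Option σ) (w : List σ) (hw : w.Nodup)
    (hx : ∀ a ∈ w, x ≠ some a) :
    ∃ f : σ → σ → ℂ, (∀ a ∈ w, f a ∈ discriminantalForms σ) ∧
      chainFrom x w = ∏ a ∈ w.toFinset, (linForm (f a))⁻¹ ∧
      ∀ v : σ → ℂ, x.elim 0 v = 0 → (∀ a ∈ w, ∑ b, f a b * v b = 0) → ∀ a ∈ w, v a = 0 := by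
  induction w generalizing x with
  | nil => exact ⟨0, by simp, by simp [chainFrom], by simp⟩
  | cons a w ih =>
    rw [List.nodup_cons] at hw
    obtain ⟨f, hf, hprod, hker⟩ := ih (some a) hw.2
      fun b hb h => hw.1 (Option.some_injective _ h ▸ hb)
    let c : σ → ℂ := Pi.single a 1 - x.elim 0 fun b => Pi.single b 1
    have hne : ∀ b ∈ w, b ≠ a := fun b hb h => hw.1 (h ▸ hb)
    have hc : c ∈ discriminantalForms σ := by
      rcases x with _ | b
      · exact Or.inl ⟨a, by simp [c]⟩
      · exact Or.inr ⟨a, b, fun h => hx a (by simp) (congrArg some h.symm), rfl⟩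
    have hlin : linForm c = tvar a - point x := by
      rw [linForm_sub, linForm_single]
      rcases x with _ | b
      · simp [linForm]
      · simp [linForm_single]
    refine ⟨Function.update f a c, ?_, ?_, ?_⟩
    · intro b hb
      rcases List.mem_cons.mp hb with rfl | hb
      · simpa using hc
      · simpa [Function.update_of_ne (hne b hb)] using hf b hb
    · rw [chainFrom, List.toFinset_cons, Finset.prod_insert (by simpa using hw.1), hprod,
        Function.update_self, hlin]
      congr 1
      refine Finset.prod_congr rfl fun b hb => ?_
      rw [Function.update_of_ne (hne b (by simpa using hb))]
    · intro v hvx hv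
      have hva : v a = 0 := by
        have h := hv a List.mem_cons_self
        rw [Function.update_self] at h
        rcases x with _ | b
        · simpa [c, Pi.single_apply] using h
        · have hvb : v b = 0 := hvx
          simpa [c, Pi.single_apply, sub_mul, Finset.sum_sub_distrib, hvb] using h
      intro b hb
      rcases List.mem_cons.mp hb with rfl | hb
      · exact hva
      · refine hker v hva (fun d hd => ?_) b hb
        simpa [Function.update_of_ne (hne d hd)] using hv d (List.mem_cons_of_mem _ hd)

/-- By triangularity the determinant is nonzero, so it can be divided out of the corresponding
generator. -/
lemma chain_mem_topLogForms {w : List σ} (hw : w.Nodup) (hmem : ∀ a, a ∈ w) :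
    chain w ∈ topLogForms σ := by
  obtain ⟨f, hf, hprod, hker⟩ := exists_forms_of_chainFrom none w hw (by simp)
  have huniv : w.toFinset = Finset.univ := by
    ext a
    simp [hmem a]
  have hdet : (Matrix.of f).det ≠ 0 := by
    intro h
    obtain ⟨v, hv, hv0⟩ := Matrix.exists_mulVec_eq_zero_iff.mpr h
    refine hv (funext fun a => hker v rfl (fun b _ => ?_) a (hmem a))
    simpa [Matrix.mulVec, dotProduct] using congrFun hv0 b
  have : chain w = (Matrix.of f).det⁻¹ • (Matrix.of f).det • (∏ u, linForm (f u))⁻¹ := by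
    rw [smul_smul, inv_mul_cancel₀ hdet, one_smul, chain, hprod, huniv, Finset.prod_inv_distrib]
  rw [this]
  exact Submodule.smul_mem _ _ (Submodule.subset_span ⟨f, fun u => hf u (hmem u), rfl⟩)

end TopForms

/-! ### Symmetric logarithmic forms and functions on words -/

section SkewForms

variable {r : ℕ} {k : Fin r → ℕ}

lemma permute_chain (π : GroupG k) (w : List (Vars k)) :
    permute π (chain w) = chain (w.map (Equiv.sigmaCongrRight π)) :=
  ratRename_chainFrom _ _ none w

lemma permute_smul (π : GroupG k) (c : ℂ) (R : RatFn (Vars k)) :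
    permute π (c • R) = c • permute π R := ratRename_smul _ _ c R

/-- The word of upper indices of an enumeration of the variables. -/
def letters {n : ℕ} (e : Fin n ≃ Vars k) : List (Fin r) := (List.ofFn e).map Sigma.fst

lemma letters_eq_iff {n : ℕ} (e : Fin n ≃ Vars k) (J : Fin n → Fin r) :
    letters e = List.ofFn J ↔ ∀ u, (e u).1 = J u := by
  rw [letters, List.map_ofFn, List.ofFn_inj, funext_iff]
  rfl

lemma nodup_ofFn_equiv {σ : Type} {n : ℕ} (e : Fin n ≃ σ) : (List.ofFn e).Nodup :=
  List.nodup_ofFn.mpr e.injective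

lemma iterRes_chain {σ : Type} [DecidableEq σ] {n : ℕ} (e e' : Fin n ≃ σ) :
    iterRes e (chain (List.ofFn e')) = if e = e' then 1 else 0 := by
  rw [iterRes_eq_listRes, listRes_chain _ _ (nodup_ofFn_equiv e') (by simp)]
  simp only [List.ofFn_inj, DFunLike.coe_fn_eq]

/-- The symmetric form whose iterated residue at an enumeration of the variables is the value of `g`
at the word of upper indices. -/
def formOf (k : Fin r → ℕ) (g : List (Fin r) → ℂ) : RatFn (Vars k) :=
  ∑ e : Fin (∑ i, k i) ≃ Vars k, g (letters e) • chain (List.ofFn e)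

lemma iterRes_sum_chain (ρ : (Fin (∑ i, k i) ≃ Vars k) → ℂ) (e : Fin (∑ i, k i) ≃ Vars k) :
    iterRes e (∑ e', ρ e' • chain (List.ofFn e')) = ρ e • 1 := by
  simp [iterRes_chain]

lemma permute_sum_chain (π : GroupG k) (ρ : (Fin (∑ i, k i) ≃ Vars k) → ℂ) :
    permute π (∑ e, ρ e • chain (List.ofFn e)) =
      ∑ e : Fin (∑ i, k i) ≃ Vars k, ρ (e.trans (Equiv.sigmaCongrRight π).symm) • chain (List.ofFn e) := by
  rw [map_sum]
  refine Fintype.sum_equiv (Equiv.equivCongr (Equiv.refl _) (Equiv.sigmaCongrRight π)) _ _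
    fun e => ?_
  rw [permute_smul, permute_chain, List.map_ofFn]
  have h : ((Equiv.equivCongr (Equiv.refl _) (Equiv.sigmaCongrRight π)) e).trans
      (Equiv.sigmaCongrRight π).symm = e := by
    ext1 u
    exact Equiv.symm_apply_apply (Equiv.sigmaCongrRight π) (e u)
  rw [h]
  rfl

lemma chain_ofFn_mem_topLogForms (e : Fin (∑ i, k i) ≃ Vars k) :
    chain (List.ofFn e) ∈ topLogForms (Vars k) :=
  chain_mem_topLogForms (nodup_ofFn_equiv e) fun a => by
    rw [List.mem_ofFn]
    exact e.surjective a

lemma exists_ofFn_eq {w : List (Vars k)} (hw : w.Nodup) (hmem : ∀ a, a ∈ w) :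
    ∃ e : Fin (∑ i, k i) ≃ Vars k, List.ofFn e = w := by
  have hlen : w.length = ∑ i, k i := by
    have := Fintype.card_congr (hw.getEquivOfForallMemList w hmem)
    simpa using this
  refine ⟨(finCongr hlen.symm).trans (hw.getEquivOfForallMemList w hmem), ?_⟩
  refine List.ext_getElem (by simp [hlen]) fun i h1 h2 => ?_
  simp

lemma exists_sum_chain {R : RatFn (Vars k)} (hR : R ∈ topLogForms (Vars k)) :
    ∃ ρ : (Fin (∑ i, k i) ≃ Vars k) → ℂ, R = ∑ e, ρ e • chain (List.ofFn e) := by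
  have h := topLogForms_le_span_chain hR
  have hle : Submodule.span ℂ {R | ∃ w : List (Vars k), w.Nodup ∧ (∀ a, a ∈ w) ∧ R = chain w} ≤
      Submodule.span ℂ (Set.range fun e : Fin (∑ i, k i) ≃ Vars k => chain (List.ofFn e)) := by
    refine Submodule.span_mono ?_
    rintro _ ⟨w, hw, hmem, rfl⟩
    obtain ⟨e, rfl⟩ := exists_ofFn_eq hw hmem
    exact ⟨e, rfl⟩
  obtain ⟨ρ, hρ⟩ := (Submodule.mem_span_range_iff_exists_fun ℂ).mp (hle h)
  exact ⟨ρ, hρ.symm⟩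

/-- Elements of `G_k` permute the enumerations without changing their words of upper indices. -/
lemma formOf_mem_skewForms (k : Fin r → ℕ) (g : List (Fin r) → ℂ) : formOf k g ∈ skewForms k := by
  refine ⟨Submodule.sum_mem _ fun e _ => Submodule.smul_mem _ _ (chain_ofFn_mem_topLogForms e),
    fun π => ?_⟩
  rw [formOf, permute_sum_chain]
  refine Finset.sum_congr rfl fun e _ => ?_
  congr 2
  simp only [letters, List.map_ofFn]
  congr 1

/-- The bijection `e' ∘ e⁻¹` preserves upper indices, hence splits into permutations of the blocks;
the casts only identify an upper index with the one it equals. -/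
lemma exists_groupG {n : ℕ} (e e' : Fin n ≃ Vars k) (h : ∀ u, (e u).1 = (e' u).1) :
    ∃ π : GroupG k, e' = e.trans (Equiv.sigmaCongrRight π) := by
  have h1 : ∀ a, (e' (e.symm a)).1 = a.1 := fun a => by rw [← h, Equiv.apply_symm_apply]
  have h2 : ∀ a, (e (e'.symm a)).1 = a.1 := fun a => by rw [h, Equiv.apply_symm_apply]
  let φ : ∀ i, Fin (k i) → Fin (k i) := fun i x =>
    Fin.cast (congrArg k (h1 ⟨i, x⟩)) (e' (e.symm ⟨i, x⟩)).2
  let ψ : ∀ i, Fin (k i) → Fin (k i) := fun i x =>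
    Fin.cast (congrArg k (h2 ⟨i, x⟩)) (e (e'.symm ⟨i, x⟩)).2
  have aux : ∀ (b : Vars k) (i : Fin r) (hb : b.1 = i), 
      (⟨i, Fin.cast (congrArg k hb) b.2⟩ : Vars k) = b := by
    rintro b _ rfl
    rfl
  have hφ : ∀ i x, (⟨i, φ i x⟩ : Vars k) = e' (e.symm ⟨i, x⟩) := fun i x => aux _ i (h1 ⟨i, x⟩)
  have hψ : ∀ i x, (⟨i, ψ i x⟩ : Vars k) = e (e'.symm ⟨i, x⟩) := fun i x => aux _ i (h2 ⟨i, x⟩)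
  refine ⟨fun i => ⟨φ i, ψ i, fun x => ?_, fun x => ?_⟩, ?_⟩
  · have : (⟨i, ψ i (φ i x)⟩ : Vars k) = ⟨i, x⟩ := by simp [hψ, hφ]
    simpa using this
  · have : (⟨i, φ i (ψ i x)⟩ : Vars k) = ⟨i, x⟩ := by simp [hψ, hφ]
    simpa using this
  · ext1 u
    have := hφ (e u).1 (e u).2
    simp only [Sigma.eta, Equiv.symm_apply_apply] at this
    rw [← this]
    rfl

/-- Invariance makes the chain coefficients constant on `G_k`-orbits of enumerations, which are the
fibres of `letters`. -/
lemma exists_eq_formOf {R : RatFn (Vars k)} (hR : R ∈ skewForms k) :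
    ∃ g : List (Fin r) → ℂ, R = formOf k g := by
  classical
  obtain ⟨ρ, hρ⟩ := exists_sum_chain hR.1
  have hinv : ∀ e e' : Fin (∑ i, k i) ≃ Vars k, letters e = letters e' → ρ e = ρ e' := by
    intro e e' h
    have h' : ∀ u, (e u).1 = (e' u).1 := by
      rw [← letters_eq_iff, h, letters_eq_iff]
      exact fun _ => rfl
    obtain ⟨π, rfl⟩ := exists_groupG e e' h'
    have h1 := congrArg (iterRes (e.trans (Equiv.sigmaCongrRight π))) (hR.2 π)
    rw [hρ, permute_sum_chain, iterRes_sum_chain, iterRes_sum_chain] at h1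
    have h2 : (e.trans (Equiv.sigmaCongrRight π)).trans (Equiv.sigmaCongrRight π).symm = e := by
      ext1 u
      simp
    rw [h2] at h1
    exact smul_left_injective ℂ (one_ne_zero (α := RatFn (Vars k))) h1
  -- `formOf` never reads `g` at a word that comes from no enumeration, so the value `0` there is
  -- arbitrary.
  refine ⟨fun w => if h : ∃ e : Fin (∑ i, k i) ≃ Vars k, letters e = w then ρ h.choose else 0, ?_⟩
  rw [hρ, formOf]
  refine Finset.sum_congr rfl fun e _ => ?_
  have h : ∃ e' : Fin (∑ i, k i) ≃ Vars k, letters e' = letters e := ⟨e, rfl⟩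
  rw [dif_pos h, hinv _ _ h.choose_spec]

lemma eq_of_forall_iterRes_eq {R S : RatFn (Vars k)} (hR : R ∈ topLogForms (Vars k))
    (hS : S ∈ topLogForms (Vars k)) (h : ∀ e, iterRes e R = iterRes (n := ∑ i, k i) e S) :
    R = S := by
  obtain ⟨ρ, rfl⟩ := exists_sum_chain hR
  obtain ⟨ρ', rfl⟩ := exists_sum_chain hS
  refine Finset.sum_congr rfl fun e _ => ?_
  have := h e
  rw [iterRes_sum_chain, iterRes_sum_chain] at this
  rw [smul_left_injective ℂ (one_ne_zero (α := RatFn (Vars k))) this]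

lemma exists_enumeration {J : Fin (∑ i, k i) → Fin r} (hJ : IsMultiIndex k J) :
    ∃ e : Fin (∑ i, k i) ≃ Vars k, ∀ u, (e u).1 = J u := by
  have h : ∀ i, Nonempty ({u // J u = i} ≃ Fin (k i)) := fun i =>
    ⟨Fintype.equivFinOfCardEq (by rw [Fintype.card_subtype, hJ i])⟩
  let φ := fun i => (h i).some
  exact ⟨(Equiv.sigmaFiberEquiv J).symm.trans (Equiv.sigmaCongrRight φ), fun u => rfl⟩

open scoped Classical in
-- The enumerations with upper indices `J` form a torsor under `G_k`.
lemma card_enumerations {J : Fin (∑ i, k i) → Fin r} (hJ : IsMultiIndex k J) :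
    (Finset.univ.filter fun e : Fin (∑ i, k i) ≃ Vars k => ∀ u, (e u).1 = J u).card =
      ∏ i, (k i).factorial := by
  obtain ⟨e, he⟩ := exists_enumeration hJ
  have hcard : Fintype.card (GroupG k) = ∏ i, (k i).factorial := by
    rw [Fintype.card_pi]
    simp [Fintype.card_perm]
  rw [← hcard, ← Finset.card_univ]
  symm
  refine Finset.card_bij (fun π _ => e.trans (Equiv.sigmaCongrRight π)) ?_ ?_ ?_
  · intro π _
    simpa using he
  · intro π _ π' _ h
    have h' : ∀ a, Equiv.sigmaCongrRight π a = Equiv.sigmaCongrRight π' a := fun a => by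
      simpa using DFunLike.congr_fun h (e.symm a)
    funext i
    ext1 x
    simpa using h' ⟨i, x⟩
  · intro e' he'
    rw [Finset.mem_filter] at he'
    obtain ⟨π, hπ⟩ := exists_groupG e e' fun u => by rw [he, he'.2]
    exact ⟨π, Finset.mem_univ _, hπ.symm⟩

lemma enumSign_mul_self (e : Fin (∑ i, k i) ≃ Vars k) : enumSign e * enumSign e = 1 := by
  rw [enumSign, ← Int.cast_mul, ← Units.val_mul, Int.units_mul_self]
  simp

/-- The two signs cancel, so each of the `∏ k_i!` enumerations over `J` contributes `g(J)`, and the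
normalizing factor cancels their number. -/
lemma wordRes_formOf {J : Fin (∑ i, k i) → Fin r} (hJ : IsMultiIndex k J)
    (g : List (Fin r) → ℂ) : wordRes J (formOf k g) = g (List.ofFn J) • 1 := by
  classical
  rw [wordRes, LinearMap.smul_apply, LinearMap.sum_apply]
  have h : ∀ e ∈ Finset.univ.filter (fun e : Fin (∑ i, k i) ≃ Vars k => ∀ u, (e u).1 = J u),
      (enumSign e • flagRes e) (formOf k g) = g (List.ofFn J) • (1 : RatFn (Vars k)) := by
    intro e he
    rw [flagRes, smul_smul, enumSign_mul_self, one_smul, formOf, iterRes_sum_chain,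
      (letters_eq_iff e J).mpr (Finset.mem_filter.mp he).2]
  have hc : ((∏ i, (k i).factorial : ℕ) : ℂ) ≠ 0 :=
    Nat.cast_ne_zero.mpr (Finset.prod_ne_zero_iff.mpr fun i _ => Nat.factorial_ne_zero _)
  have h2 := Finset.sum_congr rfl h
  rw [Finset.sum_const, card_enumerations hJ, ← Nat.cast_smul_eq_nsmul ℂ] at h2
  rw [Nat.cast_prod] at h2 hc
  calc _ = (∏ i, ((k i).factorial : ℂ))⁻¹ • ((∏ i, ((k i).factorial : ℂ)) •
        g (List.ofFn J) • (1 : RatFn (Vars k))) := by rw [← h2]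
    _ = _ := inv_smul_smul₀ hc _

lemma formOf_add (g h : List (Fin r) → ℂ) : formOf k (g + h) = formOf k g + formOf k h := by
  simp [formOf, add_smul, Finset.sum_add_distrib]

lemma formOf_smul (c : ℂ) (g : List (Fin r) → ℂ) : formOf k (c • g) = c • formOf k g := by
  simp [formOf, smul_smul, Finset.smul_sum]

/-- `formOf` as a linear map to the space of skew forms. -/
def skewFormOf (k : Fin r → ℕ) : (List (Fin r) → ℂ) →ₗ[ℂ] skewForms k where
  toFun g := ⟨formOf k g, formOf_mem_skewForms k g⟩
  map_add' g h := Subtype.ext (formOf_add g h)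
  map_smul' c g := Subtype.ext (formOf_smul c g)

/-! ### The canonical element -/

lemma isMultiIndex_of_letters_eq {e : Fin (∑ i, k i) ≃ Vars k} {J : Fin (∑ i, k i) → Fin r}
    (h : letters e = List.ofFn J) : IsMultiIndex k J := by
  intro i
  rw [letters_eq_iff] at h
  rw [← Fintype.card_subtype]
  have : Fintype.card {u // J u = i} = Fintype.card {a : Vars k // a.1 = i} :=
    Fintype.card_congr (e.subtypeEquiv fun u => by rw [h u])
  rw [this, Fintype.card_congr (Equiv.sigmaSubtype i), Fintype.card_fin]

/-- The word `f̃_J` in the homogeneous part of the free algebra. -/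
def wordIn {J : Fin (∑ i, k i) → Fin r} (hJ : IsMultiIndex k J) : freePart k :=
  ⟨word J, Submodule.subset_span ⟨J, hJ, rfl⟩⟩

/-- The type of multi-indices. -/
abbrev MultiIndex (k : Fin r → ℕ) : Type := {J : Fin (∑ i, k i) → Fin r // IsMultiIndex k J}

instance : Fintype (MultiIndex k) := Fintype.ofFinite _

open scoped Classical in
/-- The skew form that is dual to `f̃_J`. -/
def dualForm (J : MultiIndex k) : skewForms k := skewFormOf k (Pi.single (List.ofFn J.1) 1)

open scoped Classical in
lemma wordRes_dualForm (I : MultiIndex k) {J : Fin (∑ i, k i) → Fin r} (hJ : IsMultiIndex k J) :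
    wordRes J (dualForm I : RatFn (Vars k)) = if J = I.1 then 1 else 0 := by
  change wordRes J (formOf k _) = _
  rw [wordRes_formOf hJ]
  simp only [Pi.single_apply, List.ofFn_inj]
  split_ifs <;> simp

lemma skewFormOf_eq_sum (g : List (Fin r) → ℂ) :
    skewFormOf k g = ∑ J : MultiIndex k, g (List.ofFn J.1) • dualForm J := by
  classical
  apply Subtype.ext
  rw [Submodule.coe_sum]
  change formOf k g = ∑ J : MultiIndex k, g (List.ofFn J.1) • formOf k _
  simp only [formOf, Finset.smul_sum]
  rw [Finset.sum_comm]
  refine Finset.sum_congr rfl fun e _ => ?_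
  have he : letters e = List.ofFn fun u => (e u).1 := (letters_eq_iff _ _).mpr fun _ => rfl
  refine Eq.trans ?_ (Finset.sum_eq_single
    (⟨fun u => (e u).1, isMultiIndex_of_letters_eq he⟩ : MultiIndex k) ?_ ?_).symm
  · simp only [he, Pi.single_eq_same, one_smul]
  · intro J _ hJ
    have : letters e ≠ List.ofFn J.1 := by
      rw [he, ne_eq, List.ofFn_inj]
      exact fun h => hJ (Subtype.ext h.symm)
    simp [this]
  · simp

/-- The canonical element of `𝒜^{G_k} ⊗ U_r[k]`. -/
def canonicalElement (k : Fin r → ℕ) : skewForms k ⊗[ℂ] freePart k :=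
  ∑ J : MultiIndex k, dualForm J ⊗ₜ wordIn J.2

lemma map_wordRes_sum (x : MultiIndex k → freePart k) (J : MultiIndex k) :
    TensorProduct.map (wordRes J.1 ∘ₗ (skewForms k).subtype) (freePart k).subtype
      (∑ I, dualForm I ⊗ₜ x I) = (1 : RatFn (Vars k)) ⊗ₜ[ℂ] (x J : FreeAlgebra ℂ (Fin r)) := by
  classical
  rw [map_sum, Finset.sum_eq_single J]
  · simp [wordRes_dualForm J J.2]
  · intro I _ hI
    have : J.1 ≠ I.1 := fun h => hI (Subtype.ext h.symm)
    simp [wordRes_dualForm I J.2, this]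
  · simp

lemma isCanonicalForm_canonicalElement (k : Fin r → ℕ) :
    IsCanonicalForm k (canonicalElement k) := fun J hJ =>
  map_wordRes_sum (fun I => wordIn I.2) ⟨J, hJ⟩

lemma exists_eq_sum_dualForm (Ω : skewForms k ⊗[ℂ] freePart k) :
    ∃ x : MultiIndex k → freePart k, Ω = ∑ J, dualForm J ⊗ₜ x J := by
  induction Ω using TensorProduct.induction_on with
  | zero => exact ⟨0, by simp⟩
  | tmul R x =>
    obtain ⟨g, hg⟩ := exists_eq_formOf R.2
    have : R = skewFormOf k g := Subtype.ext hg
    refine ⟨fun J => g (List.ofFn J.1) • x, ?_⟩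
    rw [this, skewFormOf_eq_sum, TensorProduct.sum_tmul]
    simp only [TensorProduct.smul_tmul]
  | add Ω Ω' h h' =>
    obtain ⟨x, rfl⟩ := h
    obtain ⟨y, rfl⟩ := h'
    exact ⟨x + y, by simp [TensorProduct.tmul_add, Finset.sum_add_distrib]⟩

/-- Once `Ω` is written in terms of the dual forms, contraction with `f̃_J` isolates the `J`-th
coefficient. -/
lemma IsCanonicalForm.eq_canonicalElement {Ω : skewForms k ⊗[ℂ] freePart k}
    (h : IsCanonicalForm k Ω) : Ω = canonicalElement k := by
  obtain ⟨x, rfl⟩ := exists_eq_sum_dualForm Ω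
  refine Finset.sum_congr rfl fun J _ => ?_
  have h1 := h J.1 J.2
  rw [map_wordRes_sum] at h1
  have h2 : (x J : FreeAlgebra ℂ (Fin r)) = word J.1 :=
    Algebra.TensorProduct.includeRight_injective (R := ℂ) (A := RatFn (Vars k))
      (B := FreeAlgebra ℂ (Fin r)) (algebraMap ℂ (RatFn (Vars k))).injective h1
  congr 1
  exact Subtype.ext h2

lemma existsUnique_isCanonicalForm (k : Fin r → ℕ) :
    ∃! Ω : skewForms k ⊗[ℂ] freePart k, IsCanonicalForm k Ω :=
  ⟨canonicalElement k, isCanonicalForm_canonicalElement k, fun _ h => h.eq_canonicalElement⟩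

end SkewForms

/-! ### The star product of symmetric forms -/

/-- If `f ∘ σ₀ = g`, then `f ∘ σ = g` means that `σ₀⁻¹ σ` stabilizes `g`; the set is a coset of that
stabilizer. -/
lemma card_perm_comp_eq {α β : Type*} [Fintype α] [DecidableEq α] [Fintype β] [DecidableEq β]
    (f g : α → β) (h : ∀ b, Fintype.card {a // g a = b} = Fintype.card {a // f a = b}) :
    Fintype.card {σ : Equiv.Perm α // f ∘ σ = g} =
      ∏ b, (Fintype.card {a // g a = b}).factorial := by
  let φ : ∀ b, {a // g a = b} ≃ {a // f a = b} := fun b => Fintype.equivOfCardEq (h b)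
  let σ₀ : Equiv.Perm α := ((Equiv.sigmaFiberEquiv g).symm.trans (Equiv.sigmaCongrRight φ)).trans
    (Equiv.sigmaFiberEquiv f)
  have hσ₀ : ∀ a, f (σ₀ a) = g a := fun a => (φ (g a) ⟨a, rfl⟩).2
  rw [← DomMulAct.stabilizer_card]
  refine Fintype.card_congr ((Equiv.mulLeft σ₀⁻¹).subtypeEquiv fun σ => ?_)
  simp only [funext_iff, Function.comp_apply, Equiv.coe_mulLeft, Equiv.Perm.mul_apply]
  refine forall_congr' fun a => ?_
  rw [← hσ₀ (σ₀⁻¹ (σ a))]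
  simp

section Star

variable {r : ℕ} (k l : Fin r → ℕ)

/-- The variables with the indices that the left factor of a star product occupies, moved by `π`. -/
def leftBlock (π : GroupG (k + l)) : Finset (Vars (k + l)) :=
  Finset.univ.image fun a => Equiv.sigmaCongrRight π (inclLeft k l a)

variable {k l}

lemma sigmaCongrRight_mem_leftBlock (π : GroupG (k + l)) (i : Fin r) (x : Fin (k i + l i)) :
    (⟨i, π i x⟩ : Vars (k + l)) ∈ leftBlock k l π ↔ x.val < k i := by
  simp only [leftBlock, Finset.mem_image, Finset.mem_univ, true_and]
  constructor
  · rintro ⟨a, ha⟩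
    have h : inclLeft k l a = (⟨i, x⟩ : Vars (k + l)) := (Equiv.sigmaCongrRight π).injective ha
    obtain ⟨j, y⟩ := a
    obtain rfl : j = i := congrArg Sigma.fst h
    have h2 : Fin.castAdd (l j) y = x := eq_of_heq (Sigma.mk.inj_iff.mp h).2
    rw [← h2]
    exact y.2
  · intro hx
    exact ⟨⟨i, ⟨x, hx⟩⟩, rfl⟩

lemma leftBlock_eq_iff (π : GroupG (k + l)) (T : Finset (Vars (k + l))) :
    leftBlock k l π = T ↔ ∀ i, (fun x : Fin (k i + l i) => decide ((⟨i, x⟩ : Vars (k + l)) ∈ T)) ∘ π i =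
      fun x => decide (x.val < k i) := by
  constructor
  · rintro rfl i
    funext x
    simp only [Function.comp_apply, decide_eq_decide]
    exact sigmaCongrRight_mem_leftBlock π i x
  · intro h
    ext a
    obtain ⟨a, rfl⟩ := (Equiv.sigmaCongrRight π).surjective a
    obtain ⟨i, x⟩ := a
    have h1 := congrFun (h i) x
    simp only [Function.comp_apply, decide_eq_decide] at h1
    exact (sigmaCongrRight_mem_leftBlock π i x).trans h1.symm

/-- This count is what the factor `1 / ∏ k_i! l_i!` in the star product compensates. For each upper
index the permutations are those that carry the first `k_i` positions onto the part of `T` with that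
index. -/
lemma card_leftBlock_eq (T : Finset (Vars (k + l)))
    (hT : ∀ i, (T.filter fun a => a.1 = i).card = k i) :
    (Finset.univ.filter fun π : GroupG (k + l) => leftBlock k l π = T).card =
      ∏ i, ((k i).factorial * (l i).factorial) := by
  have h : (Finset.univ.filter fun π : GroupG (k + l) => leftBlock k l π = T) =
      Fintype.piFinset fun i => Finset.univ.filter fun σ : Equiv.Perm (Fin (k i + l i)) =>
        (fun x : Fin (k i + l i) => decide ((⟨i, x⟩ : Vars (k + l)) ∈ T)) ∘ σ =
          fun x => decide (x.val < k i) := by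
    ext π
    rw [Fintype.mem_piFinset]
    simp only [Finset.mem_filter, Finset.mem_univ, true_and]
    exact leftBlock_eq_iff π T
  rw [h, Fintype.card_piFinset]
  refine Finset.prod_congr rfl fun i _ => ?_
  have hk : Fintype.card {x : Fin (k i + l i) // decide (x.val < k i) = true} = k i := by
    have : Fintype.card {x : Fin (k i + l i) // decide (x.val < k i) = true} = Fintype.card (Fin (k i)) :=
      Fintype.card_congr
        { toFun := fun x => ⟨x.1, by simpa using x.2⟩
          invFun := fun y => ⟨Fin.castAdd _ y, by simp⟩
          left_inv := fun x => rfl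
          right_inv := fun y => rfl }
    simpa using this
  have hTk : Fintype.card {x : Fin (k i + l i) // decide ((⟨i, x⟩ : Vars (k + l)) ∈ T) = true} =
      k i := by
    refine Eq.trans ?_ (hT i)
    rw [Fintype.card_subtype]
    refine Finset.card_bij (fun x _ => (⟨i, x⟩ : Vars (k + l))) ?_ ?_ ?_
    · intro x hx
      simpa using hx
    · intro x _ y _ hxy
      simpa using hxy
    · rintro ⟨j, x⟩ hx
      rw [Finset.mem_filter] at hx
      obtain rfl : j = i := hx.2
      exact ⟨x, by simpa using hx.1, rfl⟩
  have hcompl : ∀ c : Fin (k i + l i) → Bool, Fintype.card {x // c x = true} = k i →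
      Fintype.card {x // c x = false} = l i := by
    intro c hc
    have h1 := Fintype.card_subtype_compl fun x => c x = true
    rw [hc, Fintype.card_fin] at h1
    have h2 : Fintype.card {x // c x = false} = Fintype.card {x // ¬ c x = true} :=
      Fintype.card_congr (Equiv.subtypeEquivRight fun x => by simp)
    omega
  rw [← Fintype.card_subtype, card_perm_comp_eq]
  · rw [Fintype.prod_bool, hk, hcompl _ hk]
  · rintro (_ | _)
    · rw [hcompl _ hk, hcompl _ hTk]
    · rw [hk, hTk]

/-- Used to recognize the two subwords cut out by a left block as enumerations of the variables of
the two factors. -/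
lemma exists_enumeration_map_eq_filter {σ : Type} [DecidableEq σ] {j : Vars k → σ}
    (hj : Function.Injective j) {w : List σ} (hw : w.Nodup) (hmem : ∀ a, a ∈ w) {p : σ → Bool}
    (hp : ∀ a, p a = true ↔ a ∈ Set.range j) :
    ∃ e : Fin (∑ i, k i) ≃ Vars k, w.filter p = (List.ofFn e).map j := by
  have : w.filter p ∈ Set.range (List.map j) := by
    rw [Set.range_list_map]
    intro a ha
    exact (hp a).mp (List.mem_filter.mp ha).2
  obtain ⟨w', hw'⟩ := this
  have hn : w'.Nodup := List.Nodup.of_map j (hw' ▸ hw.filter p)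
  have hm : ∀ a, a ∈ w' := by
    intro a
    have : j a ∈ w'.map j := by
      rw [hw', List.mem_filter]
      exact ⟨hmem _, (hp _).mpr ⟨a, rfl⟩⟩
    obtain ⟨b, hb, hba⟩ := List.mem_map.mp this
    exact hj hba ▸ hb
  obtain ⟨e, rfl⟩ := exists_ofFn_eq hn hm
  exact ⟨e, hw'.symm⟩

/-- The product of the values of `g` and `h` on the subwords that `T` cuts out of a word. -/
def splitValue {ι : Type} [DecidableEq ι] (col : ι → Fin r) (g h : List (Fin r) → ℂ) (w : List ι)
    (T : Finset ι) : ℂ :=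
  g ((w.filter fun a => decide (a ∈ T)).map col) * h ((w.filter fun a => !decide (a ∈ T)).map col)

lemma permute_ratRename_mul (π : GroupG (k + l)) (g h : List (Fin r) → ℂ) :
    permute π (ratRename (inclLeft k l) (inclLeft_injective k l) (formOf k g) *
      ratRename (inclRight k l) (inclRight_injective k l) (formOf l h)) =
    ∑ e : Fin (∑ i, k i) ≃ Vars k, ∑ e' : Fin (∑ i, l i) ≃ Vars l,
      (g (letters e) * h (letters e')) •
        (chain ((List.ofFn e).map fun a => Equiv.sigmaCongrRight π (inclLeft k l a)) *
          chain ((List.ofFn e').map fun a => Equiv.sigmaCongrRight π (inclRight k l a))) := by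
  simp only [formOf, map_sum, Finset.sum_mul_sum, ratRename_smul, ratRename_chainFrom, map_mul,
    permute_smul, Option.map_none, permute_chain, List.map_map, smul_mul_smul_comm]
  rfl

variable (π : GroupG (k + l))

lemma sigmaCongrRight_inclLeft_mem (a : Vars k) :
    Equiv.sigmaCongrRight π (inclLeft k l a) ∈ leftBlock k l π :=
  Finset.mem_image_of_mem _ (Finset.mem_univ a)

lemma sigmaCongrRight_inclRight_notMem (a : Vars l) :
    Equiv.sigmaCongrRight π (inclRight k l a) ∉ leftBlock k l π := by
  have := (sigmaCongrRight_mem_leftBlock π a.1 (Fin.natAdd (k a.1) a.2)).not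
  refine this.mpr ?_
  simp

lemma inclLeft_or_inclRight (a : Vars (k + l)) :
    (∃ b, a = inclLeft k l b) ∨ ∃ b, a = inclRight k l b := by
  obtain ⟨i, x⟩ := a
  change Fin (k i + l i) at x
  induction x using Fin.addCases with
  | left x => exact Or.inl ⟨⟨i, x⟩, rfl⟩
  | right x => exact Or.inr ⟨⟨i, x⟩, rfl⟩

lemma notMem_leftBlock_iff (a : Vars (k + l)) : a ∉ leftBlock k l π ↔
    a ∈ Set.range fun b => Equiv.sigmaCongrRight π (inclRight k l b) := by
  constructor
  · intro ha
    obtain ⟨a, rfl⟩ := (Equiv.sigmaCongrRight π).surjective a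
    rcases inclLeft_or_inclRight a with ⟨b, rfl⟩ | ⟨b, rfl⟩
    · exact absurd (sigmaCongrRight_inclLeft_mem π b) ha
    · exact ⟨b, rfl⟩
  · rintro ⟨b, rfl⟩
    exact sigmaCongrRight_inclRight_notMem π b

lemma nodup_map_sigmaCongrRight {m n : Fin r → ℕ} (π : GroupG n) {j : Vars m → Vars n}
    (hj : Function.Injective j) {c : ℕ} (e : Fin c ≃ Vars m) :
    ((List.ofFn e).map fun a => Equiv.sigmaCongrRight π (j a)).Nodup :=
  (nodup_ofFn_equiv e).map ((Equiv.sigmaCongrRight π).injective.comp hj)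

/-- After expansion into products of two chains, only one product has a nonzero residue at `e₀`: its
chains are the subwords of `e₀` inside and outside the left block. -/
lemma iterRes_permute_mul (g h : List (Fin r) → ℂ) (e₀ : Fin (∑ i, (k + l) i) ≃ Vars (k + l)) :
    iterRes e₀ (permute π (ratRename (inclLeft k l) (inclLeft_injective k l) (formOf k g) *
      ratRename (inclRight k l) (inclRight_injective k l) (formOf l h))) =
      splitValue Sigma.fst g h (List.ofFn e₀) (leftBlock k l π) • 1 := by
  have hL : Function.Injective fun a => Equiv.sigmaCongrRight π (inclLeft k l a) :=
    (Equiv.sigmaCongrRight π).injective.comp (inclLeft_injective k l)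
  have hR : Function.Injective fun a => Equiv.sigmaCongrRight π (inclRight k l a) :=
    (Equiv.sigmaCongrRight π).injective.comp (inclRight_injective k l)
  have hmem : ∀ a, a ∈ List.ofFn e₀ := fun a => List.mem_ofFn.mpr (e₀.surjective a)
  obtain ⟨e₁, he₁⟩ := exists_enumeration_map_eq_filter hL (nodup_ofFn_equiv e₀) hmem
    (p := fun a => decide (a ∈ leftBlock k l π)) (by simp [leftBlock])
  obtain ⟨e₂, he₂⟩ := exists_enumeration_map_eq_filter hR (nodup_ofFn_equiv e₀) hmem
    (p := fun a => !decide (a ∈ leftBlock k l π))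
    (fun a => by rw [← notMem_leftBlock_iff]; simp)
  have hres : ∀ (e : Fin (∑ i, k i) ≃ Vars k) (e' : Fin (∑ i, l i) ≃ Vars l),
      iterRes e₀ (chain ((List.ofFn e).map fun a => Equiv.sigmaCongrRight π (inclLeft k l a)) *
          chain ((List.ofFn e').map fun a => Equiv.sigmaCongrRight π (inclRight k l a))) =
        if e = e₁ ∧ e' = e₂ then 1 else 0 := by
    intro e e'
    rw [iterRes_eq_listRes, listRes_chain_mul_chain (fun a => decide (a ∈ leftBlock k l π))]
    · refine if_congr ?_ rfl rfl
      rw [he₁, he₂, hL.list_map.eq_iff, hR.list_map.eq_iff, List.ofFn_inj, List.ofFn_inj,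
        DFunLike.coe_fn_eq, DFunLike.coe_fn_eq, eq_comm, @eq_comm _ e₂]
    · exact nodup_map_sigmaCongrRight π (inclLeft_injective k l) e
    · exact nodup_map_sigmaCongrRight π (inclRight_injective k l) e'
    · intro a ha
      obtain ⟨b, -, rfl⟩ := List.mem_map.mp ha
      simpa using sigmaCongrRight_inclLeft_mem π b
    · intro a ha
      obtain ⟨b, -, rfl⟩ := List.mem_map.mp ha
      simpa using sigmaCongrRight_inclRight_notMem π b
    · simp [Finset.sum_add_distrib]
  rw [permute_ratRename_mul, map_sum, Finset.sum_eq_single e₁]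
  · rw [map_sum, Finset.sum_eq_single e₂]
    · rw [map_smul, hres, if_pos ⟨rfl, rfl⟩, splitValue, he₁, he₂, List.map_map, List.map_map]
      rfl
    · intro e' _ he'
      rw [map_smul, hres, if_neg (fun h => he' h.2), smul_zero]
    · simp
  · intro e _ he
    rw [map_sum]
    refine Finset.sum_eq_zero fun e' _ => ?_
    rw [map_smul, hres, if_neg (fun h => he h.1), smul_zero]
  · simp

/-- The two chains use complementary sets of variables, so their product is a combination of
shuffles, which are chains in all variables. -/
lemma permute_mul_mem_topLogForms (g h : List (Fin r) → ℂ) :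
    permute π (ratRename (inclLeft k l) (inclLeft_injective k l) (formOf k g) *
      ratRename (inclRight k l) (inclRight_injective k l) (formOf l h)) ∈
      topLogForms (Vars (k + l)) := by
  rw [permute_ratRename_mul]
  refine Submodule.sum_mem _ fun e _ => Submodule.sum_mem _ fun e' _ => Submodule.smul_mem _ _ ?_
  have hnd : ((List.ofFn e).map (fun a => Equiv.sigmaCongrRight π (inclLeft k l a)) ++
      (List.ofFn e').map fun a => Equiv.sigmaCongrRight π (inclRight k l a)).Nodup := by
    refine List.Nodup.append (nodup_map_sigmaCongrRight π (inclLeft_injective k l) e)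
      (nodup_map_sigmaCongrRight π (inclRight_injective k l) e') fun a ha ha' => ?_
    obtain ⟨b, -, rfl⟩ := List.mem_map.mp ha
    obtain ⟨c, -, hc⟩ := List.mem_map.mp ha'
    exact sigmaCongrRight_inclRight_notMem π c (hc ▸ sigmaCongrRight_inclLeft_mem π b)
  refine Submodule.span_le.mpr ?_ (chainFrom_mul_chainFrom_mem_span none _ _ hnd (by simp))
  rintro _ ⟨w, hw, rfl⟩
  refine chain_mem_topLogForms (hw.nodup_iff.mpr hnd) fun a => hw.mem_iff.mpr ?_
  rw [List.mem_append]
  by_cases ha : a ∈ leftBlock k l π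
  · left
    obtain ⟨b, -, rfl⟩ := Finset.mem_image.mp ha
    exact List.mem_map.mpr ⟨b, List.mem_ofFn.mpr (e.surjective b), rfl⟩
  · right
    obtain ⟨b, rfl⟩ := (notMem_leftBlock_iff π a).mp ha
    exact List.mem_map.mpr ⟨b, List.mem_ofFn.mpr (e'.surjective b), rfl⟩

/-- `g` vanishes on the words that are not of multidegree `k`. -/
def SupportedOn (k : Fin r → ℕ) (g : List (Fin r) → ℂ) : Prop :=
  ∀ w, g w ≠ 0 → ∀ i, w.count i = k i

lemma card_filter_eq_count {ι : Type} [DecidableEq ι] (col : ι → Fin r) {w : List ι} (hw : w.Nodup)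
    (T : Finset ι) (hT : T ⊆ w.toFinset) (i : Fin r) :
    (T.filter fun a => col a = i).card =
      ((w.filter fun a => decide (a ∈ T)).map col).count i := by
  rw [List.count, List.countP_map, List.countP_eq_length_filter, List.filter_filter,
    ← List.toFinset_card_of_nodup (hw.filter _)]
  congr 1
  ext a
  simp only [Finset.mem_filter, List.mem_toFinset, List.mem_filter]
  constructor
  · rintro ⟨ha, rfl⟩
    exact ⟨List.mem_toFinset.mp (hT ha), by simpa using ha⟩
  · rintro ⟨-, h⟩
    simpa [and_comm] using h

/-- Both sides are compared through their residues. Grouping the permutations by left block turns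
the symmetrization into a sum over subsets `T` of the variables. -/
lemma star_formOf {g h c : List (Fin r) → ℂ} (hg : SupportedOn k g)
    (hc : ∀ w : List (Vars (k + l)), w.Nodup → c (w.map Sigma.fst) =
      ∑ T ∈ w.toFinset.powerset, splitValue Sigma.fst g h w T) :
    star (formOf k g) (formOf l h) = formOf (k + l) c := by
  refine eq_of_forall_iterRes_eq ?_ (formOf_mem_skewForms _ c).1 fun e => ?_
  · exact Submodule.smul_mem _ _
      (Submodule.sum_mem _ fun π _ => permute_mul_mem_topLogForms π g h)
  have hform : iterRes e (formOf (k + l) c) = c (letters e) • 1 := iterRes_sum_chain _ e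
  rw [hform, letters, hc _ (nodup_ofFn_equiv e), star, symmetrize, map_smul,
    map_sum]
  simp only [iterRes_permute_mul]
  rw [← Finset.sum_smul, smul_smul]
  congr 1
  have huniv : (List.ofFn e).toFinset = Finset.univ := by
    ext a
    simpa using e.surjective a
  have hN : ∏ i, ((k i).factorial * (l i).factorial : ℂ) ≠ 0 :=
    Finset.prod_ne_zero_iff.mpr fun i _ => mul_ne_zero
      (Nat.cast_ne_zero.mpr (Nat.factorial_ne_zero _))
      (Nat.cast_ne_zero.mpr (Nat.factorial_ne_zero _))
  rw [inv_mul_eq_iff_eq_mul₀ hN, huniv, Finset.powerset_univ, Finset.mul_sum,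
    ← Finset.sum_fiberwise (s := Finset.univ) (g := leftBlock k l)]
  refine Finset.sum_congr rfl fun T _ => ?_
  have : ∀ π ∈ Finset.univ.filter (fun π : GroupG (k + l) => leftBlock k l π = T),
      splitValue Sigma.fst g h (List.ofFn e) (leftBlock k l π) =
        splitValue Sigma.fst g h (List.ofFn e) T := fun π hπ => by
    rw [(Finset.mem_filter.mp hπ).2]
  rw [Finset.sum_congr rfl this, Finset.sum_const, nsmul_eq_mul]
  -- A subset of the wrong multidegree contributes nothing because `g` is supported on multidegree
  -- `k`; for the others the number of permutations is known.
  by_cases h0 : splitValue Sigma.fst g h (List.ofFn e) T = 0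
  · rw [h0, mul_zero, mul_zero]
  · have hT : ∀ i, (T.filter fun a => a.1 = i).card = k i := fun i => by
      rw [card_filter_eq_count Sigma.fst (nodup_ofFn_equiv e) T
        (by rw [huniv]; exact Finset.subset_univ T) i]
      exact hg _ (left_ne_zero_of_mul h0) i
    rw [card_leftBlock_eq T hT]
    push_cast
    rfl

end Star

/-! ### The coproduct of the enveloping algebra and the Poincaré–Birkhoff–Witt theorem -/

section Enveloping

variable {N : Type*} [LieRing N] [LieAlgebra ℂ N]

section Coproduct

attribute [local instance] LieRing.ofAssociativeRing

local notation "UN" => UniversalEnvelopingAlgebra ℂ N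

/-- The Lie algebra morphism `x ↦ x ⊗ 1 + 1 ⊗ x`. -/
def primitiveHom : N →ₗ⁅ℂ⁆ UN ⊗[ℂ] UN where
  toFun x := UniversalEnvelopingAlgebra.ι ℂ x ⊗ₜ 1 + 1 ⊗ₜ UniversalEnvelopingAlgebra.ι ℂ x
  map_add' x y := by
    simp only [map_add, TensorProduct.add_tmul, TensorProduct.tmul_add]
    abel
  map_smul' c x := by
    simp only [map_smul, TensorProduct.smul_tmul', TensorProduct.tmul_smul, smul_add,
      RingHom.id_apply]
  map_lie' {x y} := by
    simp only [LieHom.map_lie, LieRing.of_associative_ring_bracket, mul_add, add_mul,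
      Algebra.TensorProduct.tmul_mul_tmul, one_mul, mul_one, TensorProduct.sub_tmul,
      TensorProduct.tmul_sub]
    abel

variable (N) in
/-- The coproduct of the enveloping algebra. -/
def comul : UN →ₐ[ℂ] UN ⊗[ℂ] UN :=
  UniversalEnvelopingAlgebra.lift ℂ primitiveHom

variable (N) in
/-- The counit of the enveloping algebra. -/
def counit : UN →ₐ[ℂ] ℂ :=
  UniversalEnvelopingAlgebra.lift ℂ 0

lemma comul_ι (x : N) : comul N (UniversalEnvelopingAlgebra.ι ℂ x) =
    UniversalEnvelopingAlgebra.ι ℂ x ⊗ₜ 1 + 1 ⊗ₜ UniversalEnvelopingAlgebra.ι ℂ x :=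
  UniversalEnvelopingAlgebra.lift_ι_apply ℂ _ x

lemma counit_ι (x : N) : counit N (UniversalEnvelopingAlgebra.ι ℂ x) = 0 :=
  UniversalEnvelopingAlgebra.lift_ι_apply ℂ _ x

/-- By the universal property, the map lifting `ι` into the subalgebra, followed by the inclusion,
is the identity. -/
lemma adjoin_range_ι : Algebra.adjoin ℂ (Set.range (UniversalEnvelopingAlgebra.ι ℂ (L := N))) = ⊤ := by
  set S := Algebra.adjoin ℂ (Set.range (UniversalEnvelopingAlgebra.ι ℂ (L := N)))
  let φ : N →ₗ⁅ℂ⁆ S :=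
    { toFun := fun x => ⟨UniversalEnvelopingAlgebra.ι ℂ x, Algebra.subset_adjoin ⟨x, rfl⟩⟩
      map_add' := fun x y => Subtype.ext (map_add _ x y)
      map_smul' := fun c x => Subtype.ext (map_smul _ c x)
      map_lie' := fun {x y} => Subtype.ext
        (LieHom.map_lie (UniversalEnvelopingAlgebra.ι ℂ) x y) }
  have h : S.val.comp (UniversalEnvelopingAlgebra.lift ℂ φ) = AlgHom.id ℂ _ := by
    apply UniversalEnvelopingAlgebra.hom_ext
    ext x
    change ((UniversalEnvelopingAlgebra.lift ℂ φ (UniversalEnvelopingAlgebra.ι ℂ x) : S) : UN) =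
      UniversalEnvelopingAlgebra.ι ℂ x
    rw [UniversalEnvelopingAlgebra.lift_ι_apply]
    rfl
  rw [eq_top_iff]
  intro x _
  have := DFunLike.congr_fun h x
  rw [AlgHom.id_apply] at this
  rw [← this]
  exact (UniversalEnvelopingAlgebra.lift ℂ φ x).2

lemma ι_mul_ι_sub (x y : N) : UniversalEnvelopingAlgebra.ι ℂ x * UniversalEnvelopingAlgebra.ι ℂ y -
    UniversalEnvelopingAlgebra.ι ℂ y * UniversalEnvelopingAlgebra.ι ℂ x =
      UniversalEnvelopingAlgebra.ι ℂ ⁅x, y⁆ := by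
  rw [LieHom.map_lie, LieRing.of_associative_ring_bracket]

end Coproduct

/-- The convolution product of functionals on the enveloping algebra. -/
def convolution (φ ψ : UniversalEnvelopingAlgebra ℂ N →ₗ[ℂ] ℂ) :
    UniversalEnvelopingAlgebra ℂ N →ₗ[ℂ] ℂ :=
  LinearMap.mul' ℂ ℂ ∘ₗ TensorProduct.map φ ψ ∘ₗ (comul N).toLinearMap

/-- Distributivity for ordered products, without commutativity. -/
lemma prod_ofFn_sum {A ι : Type*} [Semiring A] {m : ℕ} (S : Fin m → Finset ι) (g : Fin m → ι → A) :
    (List.ofFn fun l => ∑ i ∈ S l, g l i).prod =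
      ∑ s ∈ Fintype.piFinset S, (List.ofFn fun l => g l (s l)).prod := by
  induction m with
  | zero => simp
  | succ m ih =>
    rw [List.ofFn_succ, List.prod_cons, ih, Finset.sum_mul_sum, ← Finset.sum_product']
    refine Finset.sum_bij' (fun x _ => Fin.cons x.1 x.2) (fun s _ => (s 0, Fin.tail s)) ?_ ?_ ?_ ?_ ?_
    · intro x hx
      rw [Finset.mem_product, Fintype.mem_piFinset] at hx
      rw [Fintype.mem_piFinset]
      exact Fin.cases hx.1 hx.2
    · intro s hs
      rw [Fintype.mem_piFinset] at hs
      rw [Finset.mem_product, Fintype.mem_piFinset]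
      exact ⟨hs 0, fun l => hs l.succ⟩
    · intro x _
      simp
    · intro s _
      exact Fin.cons_self_tail s
    · intro x _
      simp [List.ofFn_succ]

lemma prod_ofFn_smul_tmul {A : Type*} [Ring A] [Algebra ℂ A] {m : ℕ} (c : Fin m → ℂ)
    (x y : Fin m → A) : (List.ofFn fun l => c l • (x l ⊗ₜ[ℂ] y l)).prod =
      (∏ l, c l) • ((List.ofFn x).prod ⊗ₜ[ℂ] (List.ofFn y).prod) := by
  induction m with
  | zero => simp [Algebra.TensorProduct.one_def]
  | succ m ih =>
    simp only [List.ofFn_succ, List.prod_cons, ih, Fin.prod_univ_succ, smul_mul_smul_comm,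
      Algebra.TensorProduct.tmul_mul_tmul]

variable {m : ℕ} (F : Fin m → N)

/-- The binomial theorem for each factor, as `x ⊗ 1` and `1 ⊗ x` commute. Only `a ≤ p` occur, so `p
- a` is an honest difference. -/
lemma comul_pbwMonomial (p : Fin m → ℕ) : comul N (pbwMonomial F p) =
    ∑ a ∈ Fintype.piFinset fun l => Finset.range (p l + 1),
      (∏ l, ((p l).choose (a l) : ℂ)) • (pbwMonomial F a ⊗ₜ[ℂ] pbwMonomial F (p - a)) := by
  have h : ∀ l, comul N (UniversalEnvelopingAlgebra.ι ℂ (F l) ^ p l) =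
      ∑ i ∈ Finset.range (p l + 1), ((p l).choose i : ℂ) •
        ((UniversalEnvelopingAlgebra.ι ℂ (F l) ^ i) ⊗ₜ[ℂ]
          (UniversalEnvelopingAlgebra.ι ℂ (F l) ^ (p l - i))) := by
    intro l
    rw [map_pow, comul_ι, Commute.add_pow]
    · refine Finset.sum_congr rfl fun i _ => ?_
      rw [Algebra.TensorProduct.tmul_pow, Algebra.TensorProduct.tmul_pow, one_pow, one_pow,
        Algebra.TensorProduct.tmul_mul_tmul, one_mul, mul_one, (Nat.commute_cast _ _).eq,
        ← nsmul_eq_mul, Nat.cast_smul_eq_nsmul]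
    · rw [Commute, SemiconjBy, Algebra.TensorProduct.tmul_mul_tmul,
        Algebra.TensorProduct.tmul_mul_tmul]
      simp
  rw [pbwMonomial, map_list_prod, List.map_ofFn]
  have h' : (comul N ∘ fun l => UniversalEnvelopingAlgebra.ι ℂ (F l) ^ p l) = fun l =>
      ∑ i ∈ Finset.range (p l + 1), ((p l).choose i : ℂ) •
        ((UniversalEnvelopingAlgebra.ι ℂ (F l) ^ i) ⊗ₜ[ℂ]
          (UniversalEnvelopingAlgebra.ι ℂ (F l) ^ (p l - i))) := funext h
  rw [h', prod_ofFn_sum]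
  refine Finset.sum_congr rfl fun a _ => ?_
  rw [prod_ofFn_smul_tmul]
  rfl

/-- If only the term of `e_l` contributes to a convolution at a monomial, its value is that term. -/
lemma convolution_pbwMonomial (φ ψ : UniversalEnvelopingAlgebra ℂ N →ₗ[ℂ] ℂ) (p : Fin m → ℕ)
    (l : Fin m) (hφ : φ (pbwMonomial F (Pi.single l 1)) = 1)
    (h : ∀ a ≤ p, a ≠ Pi.single l 1 → φ (pbwMonomial F a) * ψ (pbwMonomial F (p - a)) = 0) :
    convolution φ ψ (pbwMonomial F p) = p l * ψ (pbwMonomial F (p - Pi.single l 1)) := by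
  have hle : ∀ a, a ∈ Fintype.piFinset (fun l => Finset.range (p l + 1)) ↔ a ≤ p := by
    intro a
    simp [Fintype.mem_piFinset, Pi.le_def]
  simp only [convolution, LinearMap.comp_apply, AlgHom.toLinearMap_apply, comul_pbwMonomial,
    map_sum, map_smul, TensorProduct.map_tmul, LinearMap.mul'_apply, smul_eq_mul]
  rw [Finset.sum_eq_single (Pi.single l 1)]
  · rw [hφ, one_mul]
    congr 1
    rw [Finset.prod_eq_single l]
    · simp
    · intro j _ hj
      simp [hj]
    · simp
  · intro a ha hal
    rw [h a ((hle a).mp ha) hal, mul_zero]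
  -- If `e_l` is not below `p`, then `p l = 0`, and the term vanishes through `Nat.choose 0 1 = 0`.
  · intro hn
    rw [Fintype.mem_piFinset] at hn
    push Not at hn
    obtain ⟨j, hj⟩ := hn
    obtain rfl : j = l := by
      by_contra hjl
      simp [hjl] at hj
    have : p j = 0 := by
      simp at hj
      omega
    rw [Finset.prod_eq_zero (Finset.mem_univ j) (by simp [this]), zero_mul]

lemma pbwMonomial_zero : pbwMonomial F 0 = 1 := by
  simp [pbwMonomial]

lemma prod_ofFn_single {A : Type*} [Monoid A] {m : ℕ} (x : Fin m → A) (l : Fin m) :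
    (List.ofFn fun j => x j ^ (Pi.single l 1 : Fin m → ℕ) j).prod = x l := by
  induction m with
  | zero => exact l.elim0
  | succ m ih =>
    rw [List.ofFn_succ, List.prod_cons]
    cases l using Fin.cases with
    | zero => simp
    | succ l =>
      have := ih (fun j => x j.succ) l
      have h2 : ∀ j : Fin m, (Pi.single l.succ 1 : Fin (m + 1) → ℕ) j.succ =
          (Pi.single l 1 : Fin m → ℕ) j := fun j => by simp [Pi.single_apply]
      simp only [h2, this]
      simp

lemma pbwMonomial_single (l : Fin m) :
    pbwMonomial F (Pi.single l 1) = UniversalEnvelopingAlgebra.ι ℂ (F l) :=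
  prod_ofFn_single (fun l => UniversalEnvelopingAlgebra.ι ℂ (F l)) l

/-- A coordinate functional is extended to the whole algebra; subtracting a multiple of the counit
kills `1` without changing the values on the `ι (F j)`. -/
lemma exists_linearForm (hF : LinearIndependent ℂ fun l => UniversalEnvelopingAlgebra.ι ℂ (F l))
    (l : Fin m) : ∃ ξ : UniversalEnvelopingAlgebra ℂ N →ₗ[ℂ] ℂ, ξ 1 = 0 ∧
      ∀ j, ξ (UniversalEnvelopingAlgebra.ι ℂ (F j)) = if j = l then 1 else 0 := by
  classical
  let B := Module.Basis.span hF
  obtain ⟨ξ, hξ⟩ := (B.coord l).exists_extend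
  refine ⟨ξ - (ξ 1) • (counit N).toLinearMap, by simp, fun j => ?_⟩
  have h1 : ξ (UniversalEnvelopingAlgebra.ι ℂ (F j)) = B.coord l (B j) := by
    rw [← hξ]
    rw [LinearMap.comp_apply, Submodule.subtype_apply, Module.Basis.span_apply]
  rw [LinearMap.sub_apply, LinearMap.smul_apply, AlgHom.toLinearMap_apply, counit_ι, h1]
  simp [Finsupp.single_apply]

/-- A functional that picks out the ordered monomial `F^q` among those of degree at most `n = |q|`. -/
lemma exists_iterated_convolution
    (hF : LinearIndependent ℂ fun l => UniversalEnvelopingAlgebra.ι ℂ (F l)) (n : ℕ) :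
    ∀ q : Fin m → ℕ, ∑ l, q l = n → ∃ ψ : UniversalEnvelopingAlgebra ℂ N →ₗ[ℂ] ℂ,
      ∀ p : Fin m → ℕ, ∑ l, p l ≤ n → (ψ (pbwMonomial F p) ≠ 0 ↔ p = q) := by
  induction n with
  | zero =>
    intro q hq
    refine ⟨(counit N).toLinearMap, fun p hp => ?_⟩
    have h0 : ∀ p : Fin m → ℕ, ∑ l, p l = 0 → p = 0 := fun p hp => by
      funext l
      exact Finset.sum_eq_zero_iff.mp hp l (Finset.mem_univ l)
    rw [h0 q hq, h0 p (Nat.le_zero.mp hp), pbwMonomial_zero]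
    simp
  | succ n ih =>
    intro q hq
    obtain ⟨l, -, hl⟩ : ∃ l ∈ Finset.univ, q l ≠ 0 := by
      apply Finset.exists_ne_zero_of_sum_ne_zero
      omega
    have hsum : ∀ a p : Fin m → ℕ, a ≤ p → ∑ l, a l + ∑ l, (p - a) l = ∑ l, p l := by
      intro a p hap
      rw [← Finset.sum_add_distrib]
      exact Finset.sum_congr rfl fun j _ => Nat.add_sub_of_le (hap j)
    have hsingle : ∀ p : Fin m → ℕ, p l ≠ 0 → (Pi.single l 1 : Fin m → ℕ) ≤ p := by
      intro p hp j
      by_cases hj : j = l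
      · subst hj
        simpa using Nat.one_le_iff_ne_zero.mpr hp
      · simp [hj]
    have hone : ∑ j, (Pi.single l 1 : Fin m → ℕ) j = 1 := by simp
    obtain ⟨ψ, hψ⟩ := ih (q - Pi.single l 1) (by have := hsum _ q (hsingle q hl); omega)
    obtain ⟨ξ, hξ1, hξ⟩ := exists_linearForm F hF l
    -- Only `a = e_l` survives at `F^p`: `ξ` kills `a = 0` and the other `a` of degree one, and if
    -- `|a| ≥ 2` the degree of `p - a` is too small for `ψ`, which there detects only `q - e_l`.
    refine ⟨convolution ξ ψ, fun p hp => ?_⟩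
    rw [convolution_pbwMonomial F ξ ψ p l (by rw [pbwMonomial_single, hξ, if_pos rfl])]
    · by_cases hpl : p l = 0
      · rw [hpl, Nat.cast_zero, zero_mul]
        refine ⟨fun h => absurd rfl h, fun h => absurd ?_ hl⟩
        rw [← h, hpl]
      · have h1 := hsum _ p (hsingle p hpl)
        rw [mul_ne_zero_iff, hψ _ (by omega)]
        constructor
        · rintro ⟨-, h⟩
          calc p = Pi.single l 1 + (p - Pi.single l 1) := (add_tsub_cancel_of_le (hsingle p hpl)).symm
            _ = q := by rw [h, add_tsub_cancel_of_le (hsingle q hl)]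
        · rintro rfl
          exact ⟨Nat.cast_ne_zero.mpr hpl, rfl⟩
    · intro a hap hal
      have h1 := hsum a p hap
      rcases Nat.lt_trichotomy (∑ j, a j) 1 with h | h | h
      · have : a = 0 := by
          funext j
          exact Finset.sum_eq_zero_iff.mp (Nat.lt_one_iff.mp h) j (Finset.mem_univ j)
        rw [this, pbwMonomial_zero, hξ1, zero_mul]
      · obtain ⟨j, -, hj⟩ : ∃ j ∈ Finset.univ, a j ≠ 0 := by
          apply Finset.exists_ne_zero_of_sum_ne_zero
          omega
        have haj : a = Pi.single j 1 := by
          have h2 := Finset.add_sum_erase Finset.univ a (Finset.mem_univ j)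
          funext i
          by_cases hij : i = j
          · subst hij
            simp
            omega
          · have h3 := Finset.single_le_sum (f := a) (fun _ _ => Nat.zero_le _)
              (Finset.mem_erase.mpr ⟨hij, Finset.mem_univ i⟩)
            simp [hij]
            omega
        have hjl : j ≠ l := fun h => hal (h ▸ haj)
        rw [haj, pbwMonomial_single, hξ, if_neg hjl, zero_mul]
      · have : ψ (pbwMonomial F (p - a)) = 0 := by
          by_contra hne
          have h2 := (hψ (p - a) (by omega)).mp hne
          have h3 := hsum _ q (hsingle q hl)
          rw [← h2] at h3
          omega
        rw [this, mul_zero]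

/-- In a relation, the functional attached to a monomial of highest degree with nonzero coefficient
isolates that coefficient. The `F l` need not span `N`, so this applies inside the larger algebra
`U(𝔤)`. -/
theorem linearIndependent_pbwMonomial
    (hF : LinearIndependent ℂ fun l => UniversalEnvelopingAlgebra.ι ℂ (F l)) :
    LinearIndependent ℂ (pbwMonomial F) := by
  rw [linearIndependent_iff']
  intro s c hc
  by_contra! hcon
  let s' := s.filter fun p => c p ≠ 0
  have hs' : s'.Nonempty := by
    obtain ⟨p, hp, hcp⟩ := hcon
    exact ⟨p, by simp [s', hp, hcp]⟩
  obtain ⟨q, hq, hmax⟩ := Finset.exists_max_image s' (fun p => ∑ l, p l) hs'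
  obtain ⟨ψ, hψ⟩ := exists_iterated_convolution F hF _ q rfl
  have h := congrArg ψ hc
  have hqs := Finset.mem_filter.mp hq
  rw [map_sum, map_zero, Finset.sum_eq_single q] at h
  · rw [map_smul, smul_eq_mul] at h
    exact mul_ne_zero hqs.2 ((hψ q le_rfl).mpr rfl) h
  · intro p hp hpq
    by_cases hcp : c p = 0
    · simp [hcp]
    · have : ψ (pbwMonomial F p) = 0 := by
        by_contra hne
        exact hpq ((hψ p (hmax p (by simp [s', hp, hcp]))).mp hne)
      simp [this]
  · exact fun h => absurd hqs.1 h

/-- The list of indices with `p l` entries `l`, in increasing order. -/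
def sortedList (p : Fin m → ℕ) : List (Fin m) := (List.ofFn fun l => List.replicate (p l) l).flatten

lemma count_sortedList (p : Fin m → ℕ) (l : Fin m) : (sortedList p).count l = p l := by
  rw [sortedList, List.count_flatten, List.map_ofFn, List.sum_ofFn, Finset.sum_eq_single l]
  · simp
  · intro j _ hj
    simp [List.count_replicate, hj]
  · simp

/-- The product of the elements of `𝔫` with the indices in a list. -/
def listMonomial (w : List (Fin m)) : UniversalEnvelopingAlgebra ℂ N :=
  (w.map fun l => UniversalEnvelopingAlgebra.ι ℂ (F l)).prod

lemma listMonomial_cons (l : Fin m) (w : List (Fin m)) :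
    listMonomial F (l :: w) = UniversalEnvelopingAlgebra.ι ℂ (F l) * listMonomial F w := by
  simp only [listMonomial, List.map_cons, List.prod_cons]

lemma listMonomial_append (v w : List (Fin m)) :
    listMonomial F (v ++ w) = listMonomial F v * listMonomial F w := by
  simp only [listMonomial, List.map_append, List.prod_append]

lemma listMonomial_sortedList (p : Fin m → ℕ) : listMonomial F (sortedList p) = pbwMonomial F p := by
  rw [listMonomial, sortedList, List.map_flatten, List.prod_flatten, List.map_ofFn, List.map_ofFn,
    pbwMonomial]
  congr 2
  funext l
  simp only [Function.comp_apply, List.map_replicate, List.prod_replicate]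

/-- Swapping two neighbours costs their bracket, a combination of the `F l`, so the error terms are
shorter. -/
lemma listMonomial_sub_mem_span (hF : Submodule.span ℂ (Set.range F) = ⊤) {v w : List (Fin m)}
    (h : v.Perm w) : listMonomial F v - listMonomial F w ∈
      Submodule.span ℂ {x | ∃ u : List (Fin m), u.length < v.length ∧ x = listMonomial F u} := by
  induction h with
  | nil => simp
  | @cons l v w _ ih =>
    rw [listMonomial_cons, listMonomial_cons, ← mul_sub]
    generalize listMonomial F v - listMonomial F w = x at ih
    induction ih using Submodule.span_induction with
    | mem x hx =>
      obtain ⟨u, hu, rfl⟩ := hx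
      exact Submodule.subset_span ⟨l :: u, by simpa using hu, (listMonomial_cons F l u).symm⟩
    | zero => simp
    | add x y _ _ hx hy => rw [mul_add]; exact add_mem hx hy
    | smul c x _ hx => rw [mul_smul_comm]; exact Submodule.smul_mem _ _ hx
  | swap i j w =>
    simp only [listMonomial_cons]
    rw [← mul_assoc, ← mul_assoc, ← sub_mul, ι_mul_ι_sub]
    have h : ⁅F j, F i⁆ ∈ Submodule.span ℂ (Set.range F) := hF ▸ Submodule.mem_top
    generalize ⁅F j, F i⁆ = z at h
    induction h using Submodule.span_induction with
    | mem x hx =>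
      obtain ⟨l, rfl⟩ := hx
      exact Submodule.subset_span ⟨l :: w, by simp, (listMonomial_cons F l w).symm⟩
    | zero => rw [map_zero, zero_mul]; exact zero_mem _
    | add x y _ _ hx hy => rw [map_add, add_mul]; exact add_mem hx hy
    | smul c x _ hx => rw [map_smul, smul_mul_assoc]; exact Submodule.smul_mem _ _ hx
  | trans h h' ih ih' =>
    rw [← h.length_eq] at ih'
    simpa using add_mem ih ih'

/-- Strong induction on the length: sorting the list changes the product only by shorter ones. -/
lemma listMonomial_mem_span (hF : Submodule.span ℂ (Set.range F) = ⊤) (w : List (Fin m)) :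
    listMonomial F w ∈ Submodule.span ℂ (Set.range (pbwMonomial F)) := by
  induction hn : w.length using Nat.strong_induction_on generalizing w with
  | _ n ih =>
    have hperm : w.Perm (sortedList fun l => w.count l) := by
      rw [List.perm_iff_count]
      exact fun l => (count_sortedList (fun l => w.count l) l).symm
    have h := listMonomial_sub_mem_span F hF hperm
    have hle : Submodule.span ℂ {x | ∃ u : List (Fin m), u.length < w.length ∧
        x = listMonomial F u} ≤ Submodule.span ℂ (Set.range (pbwMonomial F)) := by
      rw [Submodule.span_le]
      rintro _ ⟨u, hu, rfl⟩
      exact ih u.length (hn ▸ hu) u rfl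
    rw [← sub_add_cancel (listMonomial F w) (listMonomial F (sortedList fun l => w.count l))]
    refine add_mem (hle h) (Submodule.subset_span ⟨fun l => w.count l, ?_⟩)
    rw [listMonomial_sortedList]

theorem span_pbwMonomial (hF : Submodule.span ℂ (Set.range F) = ⊤) :
    Submodule.span ℂ (Set.range (pbwMonomial F)) = ⊤ := by
  have hle : Submodule.span ℂ (Set.range (listMonomial F)) ≤
      Submodule.span ℂ (Set.range (pbwMonomial F)) := by
    rw [Submodule.span_le]
    rintro _ ⟨w, rfl⟩
    exact listMonomial_mem_span F hF w
  rw [eq_top_iff]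
  refine le_trans ?_ hle
  intro x _
  have hx : x ∈ Algebra.adjoin ℂ (Set.range (UniversalEnvelopingAlgebra.ι ℂ (L := N))) :=
    adjoin_range_ι (N := N) ▸ Algebra.mem_top
  have hone : (1 : UniversalEnvelopingAlgebra ℂ N) ∈ Submodule.span ℂ (Set.range (listMonomial F)) :=
    Submodule.subset_span ⟨[], by simp [listMonomial]⟩
  induction hx using Algebra.adjoin_induction with
  | mem x hx =>
    obtain ⟨y, rfl⟩ := hx
    have hy : y ∈ Submodule.span ℂ (Set.range F) := hF ▸ Submodule.mem_top
    induction hy using Submodule.span_induction with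
    | mem y hy =>
      obtain ⟨l, rfl⟩ := hy
      exact Submodule.subset_span ⟨[l], by simp only [listMonomial, List.map_cons, List.map_nil,
        List.prod_cons, List.prod_nil, mul_one]⟩
    | zero => rw [map_zero]; exact zero_mem _
    | add y z _ _ hy hz =>
      rw [map_add]
      exact add_mem (hy Submodule.mem_top) (hz Submodule.mem_top)
    | smul c y _ hy => rw [map_smul]; exact Submodule.smul_mem _ _ (hy Submodule.mem_top)
  | algebraMap c => rw [Algebra.algebraMap_eq_smul_one]; exact Submodule.smul_mem _ _ hone
  | add x y _ _ hx hy => exact add_mem (hx Submodule.mem_top) (hy Submodule.mem_top)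
  | mul x y _ _ hx hy =>
    have := Submodule.mul_mem_mul (hx Submodule.mem_top) (hy Submodule.mem_top)
    rw [Submodule.span_mul_span] at this
    refine Submodule.span_mono ?_ this
    rintro _ ⟨_, ⟨v, rfl⟩, _, ⟨w, rfl⟩, rfl⟩
    exact ⟨v ++ w, listMonomial_append F v w⟩

/-! ### Words in the generators -/

section Words

variable {r : ℕ} (f : Fin r → N)

/-- The image in the enveloping algebra of the word with the given letters, read from right to
left. -/
def opWord (w : List (Fin r)) : UniversalEnvelopingAlgebra ℂ N :=
  (w.map fun i => UniversalEnvelopingAlgebra.ι ℂ (f i)).reverse.prod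

lemma opWord_nil : opWord f [] = 1 := by
  simp [opWord]

lemma opWord_cons (i : Fin r) (w : List (Fin r)) :
    opWord f (i :: w) = opWord f w * UniversalEnvelopingAlgebra.ι ℂ (f i) := by
  simp only [opWord, List.map_cons, List.reverse_cons, List.prod_append, List.prod_cons,
    List.prod_nil, mul_one]

lemma quotMap_word {n : ℕ} (J : Fin n → Fin r) : quotMap f (word J) = opWord f (List.ofFn J) := by
  rw [word, map_list_prod, List.map_reverse, opWord, List.map_ofFn, List.map_ofFn]
  congr 3
  funext u
  simp only [quotMap, Function.comp_apply, FreeAlgebra.lift_ι_apply]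

/-- Each letter is primitive and goes to one of the two factors; `T` collects the positions that go
left. Labelling positions by distinct elements of `ι` keeps repeated letters apart. -/
lemma comul_opWord {ι : Type} [DecidableEq ι] (col : ι → Fin r) {w : List ι} (hw : w.Nodup) :
    comul N (opWord f (w.map col)) = ∑ T ∈ w.toFinset.powerset,
      opWord f ((w.filter fun a => decide (a ∈ T)).map col) ⊗ₜ[ℂ]
        opWord f ((w.filter fun a => !decide (a ∈ T)).map col) := by
  induction w with
  | nil => simp [opWord_nil, Algebra.TensorProduct.one_def]
  | cons a w ih =>
    rw [List.nodup_cons] at hw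
    rw [List.map_cons, opWord_cons, map_mul, ih hw.2, comul_ι, List.toFinset_cons,
      Finset.sum_powerset_insert (by simpa using hw.1), mul_add, Finset.sum_mul, Finset.sum_mul,
      add_comm]
    congr 1
    · refine Finset.sum_congr rfl fun T hT => ?_
      have ha : a ∉ T := fun h => hw.1 (by simpa using Finset.mem_powerset.mp hT h)
      simp [ha, opWord_cons, -UniversalEnvelopingAlgebra.ι_apply]
    · refine Finset.sum_congr rfl fun T hT => ?_
      have h1 : (w.filter fun c => decide (c ∈ insert a T)) = w.filter fun c => decide (c ∈ T) := by
        refine List.filter_congr fun c hc => ?_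
        have : c ≠ a := fun h => hw.1 (h ▸ hc)
        simp [this]
      have h2 : (w.filter fun c => !decide (c ∈ insert a T)) = w.filter fun c => !decide (c ∈ T) := by
        refine List.filter_congr fun c hc => ?_
        have : c ≠ a := fun h => hw.1 (h ▸ hc)
        simp [this]
      rw [List.filter_cons_of_pos (by simp), List.filter_cons_of_neg (by simp), h1, h2,
        List.map_cons, opWord_cons, Algebra.TensorProduct.tmul_mul_tmul, mul_one]

/-- The values of a functional on the words in the generators. -/
def wordValue (φ : UniversalEnvelopingAlgebra ℂ N →ₗ[ℂ] ℂ) (w : List (Fin r)) : ℂ :=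
  φ (opWord f w)

lemma wordValue_convolution (φ ψ : UniversalEnvelopingAlgebra ℂ N →ₗ[ℂ] ℂ) {ι : Type}
    [DecidableEq ι] (col : ι → Fin r) {w : List ι} (hw : w.Nodup) :
    wordValue f (convolution φ ψ) (w.map col) =
      ∑ T ∈ w.toFinset.powerset, splitValue col (wordValue f φ) (wordValue f ψ) w T := by
  simp only [wordValue, convolution, LinearMap.comp_apply, AlgHom.toLinearMap_apply,
    comul_opWord f col hw, map_sum, TensorProduct.map_tmul, LinearMap.mul'_apply, splitValue]

/-- The bridge between forms and functionals: splitting words describes both the residues of a star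
product and the coproduct. -/
lemma star_formOf_wordValue {k l : Fin r → ℕ} (φ ψ : UniversalEnvelopingAlgebra ℂ N →ₗ[ℂ] ℂ)
    (hφ : SupportedOn k (wordValue f φ)) :
    star (formOf k (wordValue f φ)) (formOf l (wordValue f ψ)) =
      formOf (k + l) (wordValue f (convolution φ ψ)) :=
  star_formOf hφ fun _ hw => wordValue_convolution f φ ψ Sigma.fst hw

end Words

end Enveloping

/-! ### Contents -/

section Content

variable {N : Type*} [LieRing N] [LieAlgebra ℂ N] {r : ℕ} (f : Fin r → N)

lemma isMultiIndex_iff {k : Fin r → ℕ} (J : Fin (∑ i, k i) → Fin r) :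
    IsMultiIndex k J ↔ ∀ i, (List.ofFn J).count i = k i := by
  refine forall_congr' fun i => ?_
  have h := card_filter_eq_count J (List.nodup_finRange _) Finset.univ
    (fun a _ => by simp) i
  rw [List.ofFn_eq_map, h]
  simp

lemma length_eq_sum {k : Fin r → ℕ} {w : List (Fin r)} (hw : ∀ i, w.count i = k i) :
    w.length = ∑ i, k i := by
  have h := Multiset.sum_count_eq_card (s := Finset.univ) (m := (w : Multiset (Fin r)))
    fun a _ => Finset.mem_univ a
  simp only [Multiset.coe_count, hw, Multiset.coe_card] at h
  exact h.symm

lemma hasContent_iff {x : UniversalEnvelopingAlgebra ℂ N} {k : Fin r → ℕ} : HasContent f x k ↔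
    x ∈ Submodule.span ℂ {y | ∃ w : List (Fin r), (∀ i, w.count i = k i) ∧ y = opWord f w} := by
  rw [HasContent, freePart, Submodule.map_span]
  refine iff_of_eq (congrArg (fun S => x ∈ Submodule.span ℂ S) ?_)
  ext y
  constructor
  · rintro ⟨_, ⟨J, hJ, rfl⟩, rfl⟩
    exact ⟨List.ofFn J, (isMultiIndex_iff J).mp hJ, quotMap_word f J⟩
  · rintro ⟨w, hw, rfl⟩
    have hlen := length_eq_sum hw
    have hJ : List.ofFn (fun u : Fin (∑ i, k i) => w.get (Fin.cast hlen.symm u)) = w := by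
      refine List.ext_getElem (by simp [hlen]) fun i h1 h2 => ?_
      simp
    refine ⟨_, ⟨fun u => w.get (Fin.cast hlen.symm u), ?_, rfl⟩, ?_⟩
    · rw [isMultiIndex_iff, hJ]
      exact hw
    · rw [AlgHom.toLinearMap_apply, quotMap_word, hJ]

lemma hasContent_opWord {k : Fin r → ℕ} {w : List (Fin r)} (hw : ∀ i, w.count i = k i) :
    HasContent f (opWord f w) k :=
  (hasContent_iff f).mpr (Submodule.subset_span ⟨w, hw, rfl⟩)

lemma hasContent_one : HasContent f 1 0 := by
  rw [← opWord_nil f]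
  exact hasContent_opWord f (by simp)

lemma hasContent_generator (i : Fin r) :
    HasContent f (UniversalEnvelopingAlgebra.ι ℂ (f i)) (Pi.single i 1) := by
  have : UniversalEnvelopingAlgebra.ι ℂ (f i) = opWord f [i] := by
    rw [opWord_cons, opWord_nil, one_mul]
  rw [this]
  refine hasContent_opWord f fun j => ?_
  by_cases h : j = i
  · subst h
    simp
  · simp [h, Ne.symm h]

variable {f}

lemma HasContent.sub {x y : UniversalEnvelopingAlgebra ℂ N} {k : Fin r → ℕ}
    (hx : HasContent f x k) (hy : HasContent f y k) : HasContent f (x - y) k :=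
  Submodule.sub_mem _ hx hy

lemma HasContent.smul {x : UniversalEnvelopingAlgebra ℂ N} {k : Fin r → ℕ} (c : ℂ)
    (hx : HasContent f x k) : HasContent f (c • x) k :=
  Submodule.smul_mem _ c hx

lemma HasContent.mul {x y : UniversalEnvelopingAlgebra ℂ N} {k l : Fin r → ℕ}
    (hx : HasContent f x k) (hy : HasContent f y l) : HasContent f (x * y) (k + l) := by
  rw [hasContent_iff] at *
  have := Submodule.mul_mem_mul hx hy
  rw [Submodule.span_mul_span] at this
  refine Submodule.span_mono ?_ this
  rintro _ ⟨_, ⟨v, hv, rfl⟩, _, ⟨w, hw, rfl⟩, rfl⟩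
  -- The lists are concatenated in the opposite order because `opWord` reads from right to left.
  refine ⟨w ++ v, fun i => by rw [List.count_append, hv, hw, add_comm]; rfl, ?_⟩
  simp only [opWord, List.map_append, List.reverse_append, List.prod_append]

lemma HasContent.pow {x : UniversalEnvelopingAlgebra ℂ N} {k : Fin r → ℕ}
    (hx : HasContent f x k) (n : ℕ) : HasContent f (x ^ n) (n • k) := by
  induction n with
  | zero => simpa using hasContent_one f
  | succ n ih => rw [pow_succ, succ_nsmul]; exact ih.mul hx

lemma hasContent_prod_ofFn {m : ℕ} (x : Fin m → UniversalEnvelopingAlgebra ℂ N)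
    (κ : Fin m → Fin r → ℕ) (h : ∀ l, HasContent f (x l) (κ l)) :
    HasContent f (List.ofFn x).prod (∑ l, κ l) := by
  induction m with
  | zero => simpa using hasContent_one f
  | succ m ih =>
    rw [List.ofFn_succ, List.prod_cons, Fin.sum_univ_succ]
    exact (h 0).mul (ih _ _ fun l => h l.succ)

lemma hasContent_pbwMonomial {m : ℕ} {F : Fin m → N} {κ : Fin m → Fin r → ℕ}
    (h : ∀ l, HasContent f (UniversalEnvelopingAlgebra.ι ℂ (F l)) (κ l)) (p : Fin m → ℕ) :
    HasContent f (pbwMonomial F p) (∑ l, p l • κ l) :=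
  hasContent_prod_ofFn _ _ fun l => (h l).pow (p l)

end Content

/-! ### Root vectors and their contents; the PBW basis of `U(𝔫)` -/

section Roots

variable {L : Type*} [LieRing L] [LieAlgebra ℂ L] [FiniteDimensional ℂ L]
  [LieAlgebra.IsKilling ℂ L] {H : LieSubalgebra ℂ L} [H.IsCartanSubalgebra]

open LieAlgebra LieModule LieAlgebra.IsKilling

lemma exists_smul_eq_of_mem_rootSpace {χ : Weight ℂ H L} (hχ : χ.IsNonZero) {x y : L}
    (hx : x ∈ rootSpace H χ) (hx0 : x ≠ 0) (hy : y ∈ rootSpace H χ) : ∃ c : ℂ, y = c • x := by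
  obtain ⟨c, hc⟩ := (finrank_eq_one_iff_of_nonzero' (⟨x, hx⟩ : rootSpace H χ)
    (by simpa using! hx0)).mp (finrank_rootSpace_eq_one χ hχ) ⟨y, hy⟩
  exact ⟨c, (congrArg Subtype.val hc).symm⟩

/-- Representation theory of `sl₂`. Lowering a vector at the top of the `α`-string through `γ`
reaches the line of `y`; since `γ - α` is a root, the string continues, so one more lowering, by a
multiple of `x`, is nonzero. -/
lemma lie_ne_zero_of_mem_rootSpace {α γ : Weight ℂ H L} (hα : α.IsNonZero) (hγ : γ.IsNonZero)
    {x y : L} (hx : x ∈ rootSpace H (-α : H → ℂ)) (hx0 : x ≠ 0) (hy : y ∈ rootSpace H γ)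
    (hy0 : y ≠ 0) (hsum : rootSpace H (-(α : H → ℂ) + γ) ≠ ⊥) : ⁅x, y⁆ ≠ 0 := by
  obtain ⟨v, hv, hv0⟩ := (chainTop α γ).exists_ne_zero
  obtain ⟨h, e, e', isSl2, he, he'⟩ := exists_isSl2Triple_of_weight_isNonZero hα
  obtain rfl := isSl2.h_eq_coroot hα he he'
  have prim : isSl2.HasPrimitiveVectorWith v (chainLength α γ : ℂ) :=
    have := lie_mem_genWeightSpace_of_mem_genWeightSpace he hv
    ⟨hv0, (chainLength_smul _ _ hv).symm, by rwa [genWeightSpace_add_chainTop _ _ hα] at this⟩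
  have hbot : 1 ≤ chainBotCoeff α γ := by
    have := le_chainBotCoeff_of_rootSpace_ne_top α γ hα 1 (by simpa using hsum)
    exact_mod_cast this
  have hlen : chainTopCoeff α γ + 1 ≤ chainLength α γ := by
    rw [← chainTopCoeff_add_chainBotCoeff]
    omega
  have hmem := toEnd_pow_apply_mem he' hv (chainTopCoeff α γ)
  have hwt : chainTopCoeff α γ • (-α : H → ℂ) + (chainTop α γ : H → ℂ) = γ := by
    rw [coe_chainTop', smul_neg, neg_add_cancel_left]
  rw [hwt] at hmem
  obtain ⟨c, hc⟩ := exists_smul_eq_of_mem_rootSpace hγ hy hy0 hmem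
  obtain ⟨d, hd⟩ := exists_smul_eq_of_mem_rootSpace hα.neg hx hx0 he'
  intro h0
  refine prim.pow_toEnd_f_ne_zero_of_eq_nat rfl hlen ?_
  rw [pow_succ', Module.End.mul_apply, hc]
  simp [hd, h0]

variable {b : (rootSystem H).Base}

lemma isNonZero_neg_root (β : H.root) : (-(β : Weight ℂ H L)).IsNonZero :=
  (LieSubalgebra.isNonZero_coe_root β).neg

lemma mem_negRootSpace {β : H.root} {x : nilSubalgebra b} :
    x ∈ negRootSpace b β ↔ (x : L) ∈ rootSpace H (-(β.1 : H → ℂ)) := Iff.rfl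

lemma mem_nilSubalgebra {β : H.root} (hβ : b.IsPos β) {x : L}
    (hx : x ∈ rootSpace H (-(β.1 : H → ℂ))) : x ∈ nilSubalgebra b :=
  LieSubmodule.mem_iSup_of_mem (⟨β, hβ⟩ : {β : H.root // b.IsPos β}) hx

lemma exists_mem_negRootSpace {β : H.root} (hβ : b.IsPos β) :
    ∃ x ∈ negRootSpace b β, x ≠ 0 := by
  obtain ⟨x, hx, hx0⟩ := (-(β.1) : Weight ℂ H L).exists_ne_zero
  exact ⟨⟨x, mem_nilSubalgebra hβ hx⟩, hx, fun h => hx0 (congrArg Subtype.val h)⟩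

lemma exists_smul_eq_of_mem_negRootSpace {β : H.root} {x y : nilSubalgebra b}
    (hx : x ∈ negRootSpace b β) (hx0 : x ≠ 0) (hy : y ∈ negRootSpace b β) :
    ∃ c : ℂ, y = c • x := by
  obtain ⟨c, hc⟩ := exists_smul_eq_of_mem_rootSpace (isNonZero_neg_root β) hx
    (fun h => hx0 (Subtype.ext h)) hy
  exact ⟨c, Subtype.ext hc⟩

section Generators

variable {m r : ℕ} {β : Fin m ≃ {β : H.root // b.IsPos β}} {F : Fin m → nilSubalgebra b}
  (hF : ∀ l, F l ∈ negRootSpace b (β l) ∧ F l ≠ 0)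
  {α : Fin r ≃ b.support} {f : Fin r → nilSubalgebra b}
  (hf : ∀ i, f i ∈ negRootSpace b (α i) ∧ f i ≠ 0)

include hF in
lemma span_range_eq_top : Submodule.span ℂ (Set.range F) = ⊤ := by
  have hle : (negRootSum b).toSubmodule ≤
      (Submodule.span ℂ (Set.range F)).map (nilSubalgebra b).toSubmodule.subtype := by
    rw [negRootSum, LieSubmodule.iSup_toSubmodule, iSup_le_iff]
    intro γ x hx
    obtain ⟨l, rfl⟩ := β.surjective γ
    obtain ⟨c, hc⟩ := exists_smul_eq_of_mem_negRootSpace (hF l).1 (hF l).2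
      (y := ⟨x, mem_nilSubalgebra (β l).2 hx⟩) hx
    refine ⟨_, Submodule.smul_mem _ c (Submodule.subset_span ⟨l, rfl⟩), ?_⟩
    rw [← hc]
    rfl
  rw [eq_top_iff]
  intro x _
  obtain ⟨y, hy, hyx⟩ := hle x.2
  rwa [← (Subtype.ext hyx : y = x)]

include hF in
lemma linearIndependent_coe : LinearIndependent ℂ fun l => (F l : L) := by
  have hinj : Function.Injective fun l => -((β l).1.1 : H → ℂ) := by
    intro l l' h
    have h1 : ((β l).1.1 : H → ℂ) = (β l').1.1 := neg_injective h
    exact β.injective (Subtype.ext (Subtype.ext (DFunLike.coe_injective h1)))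
  have hind := (iSupIndep_genWeightSpace ℂ H L).comp hinj
  rw [← LieSubmodule.iSupIndep_toSubmodule] at hind
  exact hind.linearIndependent _ (fun l => (hF l).1) fun l h => (hF l).2 (Subtype.ext h)

include hf in
-- Induction on positive roots by adding simple roots: `⁅f i, y⁆` is nonzero, so it spans the next
-- root space, and as a commutator it has the sum of the contents.
lemma exists_content {γ : H.root} (hγ : b.IsPos γ) :
    ∃ k : Fin r → ℕ, ∀ x ∈ negRootSpace b γ,
      HasContent f (UniversalEnvelopingAlgebra.ι ℂ x) k := by
  -- Positivity is carried through the induction because the next root space must lie in `𝔫`.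
  suffices h : b.IsPos γ ∧ ∃ k : Fin r → ℕ, ∀ x ∈ negRootSpace b γ,
      HasContent f (UniversalEnvelopingAlgebra.ι ℂ x) k from h.2
  have simple : ∀ j ∈ b.support, ∃ i, ((α i : b.support) : H.root) = j := fun j hj => by
    obtain ⟨i, hi⟩ := α.surjective ⟨j, hj⟩
    exact ⟨i, congrArg Subtype.val hi⟩
  refine RootPairing.Base.IsPos.induction_on_add hγ
    (p := fun γ => b.IsPos γ ∧ ∃ k : Fin r → ℕ, ∀ x ∈ negRootSpace b γ,
      HasContent f (UniversalEnvelopingAlgebra.ι ℂ x) k) ?_ ?_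
  · intro j hj
    refine ⟨RootPairing.Base.isPos_of_mem_support hj, ?_⟩
    obtain ⟨i, rfl⟩ := simple j hj
    refine ⟨Pi.single i 1, fun x hx => ?_⟩
    obtain ⟨c, rfl⟩ := exists_smul_eq_of_mem_negRootSpace (hf i).1 (hf i).2 hx
    rw [map_smul]
    exact (hasContent_generator f i).smul c
  · rintro γ j δ hroot ⟨hpos, k, hk⟩ hj
    have hδ := hpos.add (RootPairing.Base.isPos_of_mem_support hj) hroot
    refine ⟨hδ, ?_⟩
    obtain ⟨i, rfl⟩ := simple j hj
    obtain ⟨y, hy, hy0⟩ := exists_mem_negRootSpace hpos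
    have hwt : -((α i).1.1 : H → ℂ) + ((-γ.1 : Weight ℂ H L) : H → ℂ) = -(δ.1 : H → ℂ) := by
      funext x
      have := LinearMap.congr_fun hroot x
      simp only [rootSystem_root_apply, LinearMap.add_apply, Weight.toLinear_apply] at this
      simp [this]
    have hne : ⁅f i, y⁆ ≠ 0 := by
      intro h
      refine lie_ne_zero_of_mem_rootSpace (LieSubalgebra.isNonZero_coe_root (α i).1)
        (isNonZero_neg_root γ) (hf i).1 (fun h => (hf i).2 (Subtype.ext h)) hy
        (fun h => hy0 (Subtype.ext h)) ?_ (congrArg Subtype.val h)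
      rw [hwt]
      exact (-δ.1 : Weight ℂ H L).genWeightSpace_ne_bot
    have hmem : ⁅f i, y⁆ ∈ negRootSpace b δ := by
      rw [mem_negRootSpace, ← hwt]
      exact lie_mem_genWeightSpace_of_mem_genWeightSpace (hf i).1 hy
    refine ⟨Pi.single i 1 + k, fun x hx => ?_⟩
    obtain ⟨c, rfl⟩ := exists_smul_eq_of_mem_negRootSpace hmem hne hx
    rw [map_smul, ← ι_mul_ι_sub]
    refine (HasContent.sub ((hasContent_generator f i).mul (hk y hy)) ?_).smul c
    rw [add_comm]
    exact (hk y hy).mul (hasContent_generator f i)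

end Generators

section Ambient

attribute [local instance] LieRing.ofAssociativeRing

/-- The adjoint representation is faithful, as the centre is zero, and it factors through `ι`. -/
lemma ι_injective : Function.Injective (UniversalEnvelopingAlgebra.ι ℂ : L → _) := by
  have had : Function.Injective (LieAlgebra.ad ℂ L) := by
    rw [← LieHom.ker_eq_bot, LieAlgebra.ad_ker_eq_self_module_ker,
      LieAlgebra.self_module_ker_eq_center, LieAlgebra.center_eq_bot]
  intro x y h
  apply had
  have := congrArg (UniversalEnvelopingAlgebra.lift ℂ (LieAlgebra.ad ℂ L)) h
  rwa [UniversalEnvelopingAlgebra.lift_ι_apply, UniversalEnvelopingAlgebra.lift_ι_apply] at this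

lemma linearIndependent_ι {m : ℕ} {v : Fin m → L} (hv : LinearIndependent ℂ v) :
    LinearIndependent ℂ fun l => UniversalEnvelopingAlgebra.ι ℂ (v l) :=
  hv.map' (UniversalEnvelopingAlgebra.ι ℂ (L := L)).toLinearMap
    (LinearMap.ker_eq_bot.mpr ι_injective)

variable (b) in
/-- The map `U(𝔫) → U(𝔤)`. -/
def toAmbient : UniversalEnvelopingAlgebra ℂ (nilSubalgebra b) →ₐ[ℂ]
    UniversalEnvelopingAlgebra ℂ L :=
  UniversalEnvelopingAlgebra.lift ℂ ((UniversalEnvelopingAlgebra.ι ℂ).comp (nilSubalgebra b).incl)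

lemma toAmbient_ι (x : nilSubalgebra b) : toAmbient b (UniversalEnvelopingAlgebra.ι ℂ x) =
    UniversalEnvelopingAlgebra.ι ℂ (x : L) :=
  UniversalEnvelopingAlgebra.lift_ι_apply ℂ _ x

end Ambient

lemma toAmbient_pbwMonomial {m : ℕ} (F : Fin m → nilSubalgebra b) (p : Fin m → ℕ) :
    toAmbient b (pbwMonomial F p) = pbwMonomial (fun l => (F l : L)) p := by
  rw [pbwMonomial, map_list_prod, List.map_ofFn, pbwMonomial]
  congr 2
  funext l
  rw [Function.comp_apply, map_pow, toAmbient_ι]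

variable {m r : ℕ} {β : Fin m ≃ {β : H.root // b.IsPos β}} {F : Fin m → nilSubalgebra b}
  (hF : ∀ l, F l ∈ negRootSpace b (β l) ∧ F l ≠ 0)
  {α : Fin r ≃ b.support} {f : Fin r → nilSubalgebra b}
  (hf : ∀ i, f i ∈ negRootSpace b (α i) ∧ f i ≠ 0)

include hF in
lemma linearIndependent_pbwMonomial_coe : LinearIndependent ℂ (pbwMonomial fun l => (F l : L)) :=
  linearIndependent_pbwMonomial _ (linearIndependent_ι (linearIndependent_coe hF))

/-- The basis of `U(𝔫)` that consists of the ordered monomials. -/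
def pbwBasis : Module.Basis (Fin m → ℕ) ℂ (UniversalEnvelopingAlgebra ℂ (nilSubalgebra b)) :=
  Module.Basis.mk (v := pbwMonomial F)
    -- Independence is tested in `U(𝔤)`, where the images of the root vectors are known to be
    -- independent.
    (LinearIndependent.of_comp (toAmbient b).toLinearMap (by
      have : (toAmbient b).toLinearMap ∘ pbwMonomial F = pbwMonomial fun l => (F l : L) :=
        funext fun p => toAmbient_pbwMonomial F p
      rw [this]
      exact linearIndependent_pbwMonomial_coe hF))
    (span_pbwMonomial F (span_range_eq_top hF)).ge

lemma pbwBasis_apply (p : Fin m → ℕ) : pbwBasis hF p = pbwMonomial F p :=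
  Module.Basis.mk_apply _ _ p

include hF in
-- A basis of `U(𝔫)` goes to an independent family. Injectivity is needed because the Cartan
-- elements that detect contents lie outside `𝔫`.
lemma toAmbient_injective : Function.Injective (toAmbient b) := by
  have h := linearIndependent_pbwMonomial_coe hF
  have h2 : pbwMonomial (fun l => (F l : L)) = (toAmbient b).toLinearMap ∘ pbwBasis hF :=
    funext fun p => by simp [pbwBasis_apply, toAmbient_pbwMonomial]
  rw [h2] at h
  refine (injective_iff_map_eq_zero (toAmbient b)).mpr fun x hx => ?_
  have h3 : Finsupp.linearCombination ℂ ((toAmbient b).toLinearMap ∘ pbwBasis hF)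
      ((pbwBasis hF).repr x) = 0 := by
    rw [← Finsupp.apply_linearCombination, Module.Basis.linearCombination_repr]
    exact hx
  exact (pbwBasis hF).repr.map_eq_zero_iff.mp (linearIndependent_iff.mp h _ h3)

/-- The value at `h` of the weight of an element of content `k`. -/
def contentWeight (α : Fin r ≃ b.support) (k : Fin r → ℕ) (h : H) : ℂ :=
  -∑ i, (k i : ℂ) * (α i).1.1 h

include hf in
-- The commutator with `h` is a derivation, so the weights `-α_i` of the letters add up.
lemma commutator_of_hasContent {x : UniversalEnvelopingAlgebra ℂ (nilSubalgebra b)}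
    {k : Fin r → ℕ} (hx : HasContent f x k) (h : H) :
    UniversalEnvelopingAlgebra.ι ℂ (h : L) * toAmbient b x -
      toAmbient b x * UniversalEnvelopingAlgebra.ι ℂ (h : L) =
        contentWeight α k h • toAmbient b x := by
  have hword : ∀ w : List (Fin r), UniversalEnvelopingAlgebra.ι ℂ (h : L) * toAmbient b (opWord f w) -
      toAmbient b (opWord f w) * UniversalEnvelopingAlgebra.ι ℂ (h : L) =
        contentWeight α (fun i => w.count i) h • toAmbient b (opWord f w) := by
    intro w
    induction w with
    | nil => simp [opWord_nil, contentWeight]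
    | cons i w ih =>
      have h1 : UniversalEnvelopingAlgebra.ι ℂ (h : L) * UniversalEnvelopingAlgebra.ι ℂ (f i : L) -
          UniversalEnvelopingAlgebra.ι ℂ (f i : L) * UniversalEnvelopingAlgebra.ι ℂ (h : L) =
          (-(α i).1.1 h) • UniversalEnvelopingAlgebra.ι ℂ (f i : L) := by
        rw [ι_mul_ι_sub, ← map_smul]
        congr 1
        exact lie_eq_smul_of_mem_rootSpace (hf i).1 h
      have h2 : contentWeight α (fun j => (i :: w).count j) h =
          contentWeight α (fun j => w.count j) h - (α i).1.1 h := by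
        simp [contentWeight, List.count_cons, add_mul, Finset.sum_add_distrib]
        ring
      rw [opWord_cons, map_mul, toAmbient_ι, h2, sub_smul, ← smul_mul_assoc, ← ih, sub_mul,
        mul_assoc _ _ (UniversalEnvelopingAlgebra.ι ℂ (h : L)), ← mul_assoc]
      have h3 := congrArg (toAmbient b (opWord f w) * ·) h1
      simp only [mul_sub, neg_smul, mul_neg, mul_smul_comm] at h3
      have h4 := neg_eq_iff_eq_neg.mpr h3
      rw [mul_assoc _ (UniversalEnvelopingAlgebra.ι ℂ (h : L)), ← h4]
      abel
  rw [hasContent_iff] at hx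
  induction hx using Submodule.span_induction with
  | mem x hx =>
    obtain ⟨w, hw, rfl⟩ := hx
    rw [hword]
    simp only [hw]
  | zero => simp
  | add x y _ _ hx hy =>
    rw [map_add, mul_add, add_mul, smul_add, ← hx, ← hy]
    abel
  | smul c x _ hx =>
    rw [map_smul, mul_smul_comm, smul_mul_assoc, ← smul_sub, hx, smul_comm]

lemma contentWeight_injective : Function.Injective (contentWeight (b := b) α) := by
  intro k k' hkk
  have hind := b.linearIndepOn_root
  have hind2 : LinearIndependent ℂ fun i => (rootSystem H).root (α i).1 :=
    LinearIndependent.comp hind α α.injective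
  have hsum : ∑ i, ((k i : ℂ) - k' i) • (rootSystem H).root (α i).1 = 0 := by
    ext h
    have := congrFun hkk h
    simp only [contentWeight, neg_inj] at this
    simp [sub_mul, Finset.sum_sub_distrib, this]
  funext i
  have := Fintype.linearIndependent_iff.mp hind2 _ hsum i
  exact_mod_cast sub_eq_zero.mp this

include hF hf in
lemma HasContent.unique {x : UniversalEnvelopingAlgebra ℂ (nilSubalgebra b)} (hx : x ≠ 0)
    {k k' : Fin r → ℕ} (hk : HasContent f x k) (hk' : HasContent f x k') : k = k' := by
  apply contentWeight_injective (α := α)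
  funext h
  have h0 : toAmbient b x ≠ 0 := fun h => hx (toAmbient_injective hF (h.trans (map_zero _).symm))
  exact smul_left_injective ℂ h0
    ((commutator_of_hasContent hf hk h).symm.trans (commutator_of_hasContent hf hk' h))

include hf in
-- On `U(𝔫)` the commutator with `h` is diagonal in the PBW basis, so each monomial occurring in `x`
-- has the eigenvalue of `x`, for every `h`.
lemma hasContent_of_coord_ne_zero {κ : Fin m → Fin r → ℕ}
    (hκ : ∀ l, HasContent f (UniversalEnvelopingAlgebra.ι ℂ (F l)) (κ l))
    {x : UniversalEnvelopingAlgebra ℂ (nilSubalgebra b)} {k : Fin r → ℕ} (hx : HasContent f x k)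
    {p : Fin m → ℕ} (hp : (pbwBasis hF).coord p x ≠ 0) : ∑ l, p l • κ l = k := by
  apply contentWeight_injective (α := α)
  funext h
  let D : UniversalEnvelopingAlgebra ℂ (nilSubalgebra b) →ₗ[ℂ] UniversalEnvelopingAlgebra ℂ L :=
    (LinearMap.mulLeft ℂ (UniversalEnvelopingAlgebra.ι ℂ (h : L)) -
      LinearMap.mulRight ℂ (UniversalEnvelopingAlgebra.ι ℂ (h : L))) ∘ₗ (toAmbient b).toLinearMap
  have hD : ∀ {y : UniversalEnvelopingAlgebra ℂ (nilSubalgebra b)} {k : Fin r → ℕ},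
      HasContent f y k → D y = toAmbient b (contentWeight α k h • y) := fun hy => by
    rw [map_smul, ← commutator_of_hasContent hf hy h]
    rfl
  -- The commutator `D` has values in `U(𝔤)`; `E` is its version on `U(𝔫)`, defined by the
  -- eigenvalues on the basis.
  let E : UniversalEnvelopingAlgebra ℂ (nilSubalgebra b) →ₗ[ℂ]
      UniversalEnvelopingAlgebra ℂ (nilSubalgebra b) :=
    (pbwBasis hF).constr ℂ fun p => contentWeight α (∑ l, p l • κ l) h • pbwBasis hF p
  have hEb : ∀ p, E (pbwBasis hF p) = contentWeight α (∑ l, p l • κ l) h • pbwBasis hF p :=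
    fun p => Module.Basis.constr_basis _ _ _ _
  have hE : D = (toAmbient b).toLinearMap ∘ₗ E := by
    refine (pbwBasis hF).ext fun p => ?_
    change D _ = toAmbient b (E (pbwBasis hF p))
    rw [hEb, pbwBasis_apply, hD (hasContent_pbwMonomial hκ p)]
  have hEx : E x = contentWeight α k h • x := by
    apply toAmbient_injective hF
    rw [← hD hx, hE]
    rfl
  have hcoord : (pbwBasis hF).coord p ∘ₗ E =
      contentWeight α (∑ l, p l • κ l) h • (pbwBasis hF).coord p := by
    refine (pbwBasis hF).ext fun q => ?_
    by_cases hqp : q = p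
    · subst hqp
      simp [hEb]
    · simp [hEb, hqp]
  have h1 := LinearMap.congr_fun hcoord x
  rw [LinearMap.comp_apply, hEx, map_smul, LinearMap.smul_apply, smul_eq_mul, smul_eq_mul] at h1
  exact (mul_right_cancel₀ hp h1).symm

end Roots

/-! ### The product formula -/

section GradedProducts

variable {r m : ℕ}

lemma formOf_zero (g : List (Fin r) → ℂ) : formOf 0 g = g [] • 1 := by
  have hempty : IsEmpty (Vars (0 : Fin r → ℕ)) := ⟨fun a => Fin.elim0 a.2⟩
  obtain ⟨e, he⟩ := exists_ofFn_eq (k := (0 : Fin r → ℕ)) List.nodup_nil hempty.elim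
  have : Subsingleton (Fin (∑ i, (0 : Fin r → ℕ) i) ≃ Vars (0 : Fin r → ℕ)) :=
    ⟨fun e e' => Equiv.ext fun u => hempty.elim (e u)⟩
  rw [formOf, Fintype.sum_subsingleton _ e, letters, he]
  rfl

lemma starMonomial_eq_starProd {κ : Fin m → Fin r → ℕ} (η : (l : Fin m) → RatFn (Vars (κ l)))
    (p : Fin m → ℕ) : starMonomial η p =
      starProd ((sortedList p).map fun l => (⟨κ l, η l⟩ : GradedFn r)) := by
  rw [starMonomial, sortedList, List.map_flatten, List.map_ofFn]
  simp only [Function.comp_def, List.map_replicate]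

variable {N : Type*} [LieRing N] [LieAlgebra ℂ N]

lemma convolution_smul (φ ψ : UniversalEnvelopingAlgebra ℂ N →ₗ[ℂ] ℂ) (c : ℂ) :
    convolution φ (c • ψ) = c • convolution φ ψ := by
  rw [convolution, TensorProduct.map_smul_right, LinearMap.smul_comp, LinearMap.comp_smul]
  rfl

/-- Dual to the binomial coproduct: at `F^q` only the term `F_l ⊗ F^{q - e_l}` counts, with
coefficient `q l`, which is `p l + 1` when `q = p + e_l`. -/
lemma convolution_coord {F : Fin m → N} (B : Module.Basis (Fin m → ℕ) ℂ
    (UniversalEnvelopingAlgebra ℂ N)) (hB : ∀ p, B p = pbwMonomial F p) (l : Fin m)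
    (p : Fin m → ℕ) : convolution (B.coord (Pi.single l 1)) (B.coord p) =
      ((p l : ℂ) + 1) • B.coord (p + Pi.single l 1) := by
  have hcoord : ∀ p q : Fin m → ℕ, B.coord p (pbwMonomial F q) = if q = p then 1 else 0 := by
    intro p q
    rw [← hB, Module.Basis.coord_apply, Module.Basis.repr_self, Finsupp.single_apply]
  refine B.ext fun q => ?_
  rw [hB, convolution_pbwMonomial F _ _ q l (by simp [hcoord])
    fun a _ ha => by rw [hcoord, if_neg ha, zero_mul],
    LinearMap.smul_apply, hcoord, hcoord, smul_eq_mul]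
  by_cases hq : q = p + Pi.single l 1
  · subst hq
    simp
  · rw [if_neg hq, mul_zero]
    -- With truncated subtraction `q - e_l` may equal `p` when `q l = 0`, but then the factor `q l`
    -- vanishes.
    by_cases hql : q l = 0
    · simp [hql]
    · rw [if_neg, mul_zero]
      rintro rfl
      refine hq (funext fun j => ?_)
      by_cases hj : j = l
      · subst hj
        simp
        omega
      · simp [hj]

/-- Each new factor `l` raises the exponent at `l` by one and contributes the new exponent as a
scalar, so the scalars accumulate to factorials. The order of the list plays no role. -/
lemma starProd_map_coord {F : Fin m → N} (f : Fin r → N) (B : Module.Basis (Fin m → ℕ) ℂ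
    (UniversalEnvelopingAlgebra ℂ N)) (hB : ∀ p, B p = pbwMonomial F p) (κ : Fin m → Fin r → ℕ)
    (hsupp : ∀ l, SupportedOn (κ l) (wordValue f (B.coord (Pi.single l 1)))) (w : List (Fin m)) :
    starProd (w.map fun l =>
      (⟨κ l, formOf (κ l) (wordValue f (B.coord (Pi.single l 1)))⟩ : GradedFn r)) =
    ⟨∑ l, w.count l • κ l, formOf _ (wordValue f
      ((∏ l, ((w.count l).factorial : ℂ)) • B.coord fun l => w.count l))⟩ := by
  induction w with
  | nil =>
    have h0 : ∑ l, ([] : List (Fin m)).count l • κ l = 0 := by simp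
    have h1 : wordValue f ((∏ l, ((([] : List (Fin m)).count l).factorial : ℂ)) •
        B.coord fun l => ([] : List (Fin m)).count l) [] = 1 := by
      have : (1 : UniversalEnvelopingAlgebra ℂ N) = B 0 := by rw [hB, pbwMonomial_zero]
      rw [wordValue, opWord_nil, this]
      have h2 : (fun l : Fin m => ([] : List (Fin m)).count l) = 0 := by
        funext l
        simp
      rw [h2]
      simp
    rw [h0, formOf_zero, h1, one_smul]
    rfl
  | cons l w ih =>
    have hK : ∑ j, (l :: w).count j • κ j = κ l + ∑ j, w.count j • κ j := by
      have : ∀ j, (l :: w).count j • κ j = (if j = l then κ j else 0) + w.count j • κ j := by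
        intro j
        by_cases hj : j = l
        · subst hj
          simp [add_smul, add_comm]
        · simp [hj, Ne.symm hj, List.count_cons_of_ne]
      simp [this, Finset.sum_add_distrib]
    have hcount : (fun j => (l :: w).count j) = (fun j => w.count j) + Pi.single l 1 := by
      funext j
      by_cases hj : j = l
      · subst hj
        simp
      · simp [hj, Ne.symm hj, List.count_cons_of_ne]
    have hfac : ∏ j, (((l :: w).count j).factorial : ℂ) =
        (∏ j, ((w.count j).factorial : ℂ)) * ((w.count l : ℂ) + 1) := by
      rw [← Finset.mul_prod_erase _ _ (Finset.mem_univ l),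
        ← Finset.mul_prod_erase Finset.univ (fun j => ((w.count j).factorial : ℂ))
          (Finset.mem_univ l)]
      have : ∀ j ∈ Finset.univ.erase l, (((l :: w).count j).factorial : ℂ) =
          ((w.count j).factorial : ℂ) := fun j hj => by
        rw [List.count_cons_of_ne (Finset.ne_of_mem_erase hj).symm]
      rw [Finset.prod_congr rfl this, List.count_cons_self, Nat.factorial_succ]
      push_cast
      ring
    rw [List.map_cons, starProd, ih, hK]
    dsimp only
    rw [star_formOf_wordValue f _ _ (hsupp l), convolution_smul, convolution_coord B hB, hfac,
      hcount, smul_smul]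

end GradedProducts

/-! ### The PBW expansion of the canonical form -/

section Expansion

variable {N : Type*} [LieRing N] [LieAlgebra ℂ N] {r m : ℕ} {F : Fin m → N} (f : Fin r → N)
  (B : Module.Basis (Fin m → ℕ) ℂ (UniversalEnvelopingAlgebra ℂ N))
  (hB : ∀ p, B p = pbwMonomial F p)

lemma lieForm_canonicalElement (k : Fin r → ℕ) : lieForm f (canonicalElement k) =
    ∑ J : MultiIndex k, dualForm J ⊗ₜ opWord f (List.ofFn J.1) := by
  rw [lieForm, canonicalElement, map_sum]
  refine Finset.sum_congr rfl fun J _ => ?_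
  rw [TensorProduct.map_tmul, ← quotMap_word]
  rfl

include hB in
-- Apply `id ⊗ coord_p` to both expressions for the form.
lemma IsPBWExpansion.apply_eq {k : Fin r → ℕ} {ω : (Fin m → ℕ) →₀ skewForms k}
    (h : IsPBWExpansion f F (lieForm f (canonicalElement k)) ω) (p : Fin m → ℕ) :
    ω p = skewFormOf k (wordValue f (B.coord p)) := by
  let T : skewForms k ⊗[ℂ] UniversalEnvelopingAlgebra ℂ N →ₗ[ℂ] skewForms k :=
    (TensorProduct.rid ℂ (skewForms k)).toLinearMap ∘ₗ
      TensorProduct.map LinearMap.id (B.coord p)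
  have hT : ∀ R x, T (R ⊗ₜ x) = B.coord p x • R := fun R x => by
    simp [T]
  have h1 := congrArg T h.2
  rw [lieForm_canonicalElement, map_sum, Finsupp.sum, map_sum] at h1
  simp only [hT] at h1
  rw [skewFormOf_eq_sum]
  refine Eq.trans ?_ h1.symm
  simp only [← hB, Module.Basis.coord_apply, Module.Basis.repr_self, Finsupp.single_apply,
    ite_smul, one_smul, zero_smul, Finset.sum_ite_eq', Finsupp.mem_support_iff]
  split_ifs with h0
  · rfl
  · exact not_not.mp h0

include hB in
-- For existence, every word occurring in the canonical element is expanded in the PBW basis; `S`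
-- collects the finitely many exponents that appear.
lemma existsUnique_isPBWExpansion {k : Fin r → ℕ}
    (hcontent : ∀ (w : List (Fin r)) (p : Fin m → ℕ), B.coord p (opWord f w) ≠ 0 →
      HasContent f (pbwMonomial F p) fun i => w.count i) :
    ∃! ω : (Fin m → ℕ) →₀ skewForms k,
      IsPBWExpansion f F (lieForm f (canonicalElement k)) ω := by
  classical
  let S : Finset (Fin m → ℕ) := Finset.univ.biUnion fun J : MultiIndex k =>
    (B.repr (opWord f (List.ofFn J.1))).support
  have hS : ∀ p, skewFormOf k (wordValue f (B.coord p)) ≠ 0 →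
      ∃ J : MultiIndex k, B.coord p (opWord f (List.ofFn J.1)) ≠ 0 := by
    intro p hp
    by_contra! h
    refine hp ?_
    rw [skewFormOf_eq_sum]
    exact Finset.sum_eq_zero fun J _ => by rw [wordValue, h J, zero_smul]
  refine ⟨Finsupp.onFinset S (fun p => skewFormOf k (wordValue f (B.coord p))) ?_, ⟨?_, ?_⟩, ?_⟩
  · intro p hp
    obtain ⟨J, hJ⟩ := hS p hp
    exact Finset.mem_biUnion.mpr ⟨J, Finset.mem_univ _, Finsupp.mem_support_iff.mpr (by exact hJ)⟩
  · intro p hp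
    obtain ⟨J, hJ⟩ := hS p (Finsupp.mem_support_iff.mp hp)
    have h := hcontent _ _ hJ
    rwa [funext ((isMultiIndex_iff J.1).mp J.2)] at h
  · rw [lieForm_canonicalElement]
    refine Eq.trans ?_ (Finsupp.onFinset_sum (g := fun p R => R ⊗ₜ[ℂ] pbwMonomial F p) _
      fun p => TensorProduct.zero_tmul _ _).symm
    simp only [skewFormOf_eq_sum, TensorProduct.sum_tmul, TensorProduct.smul_tmul]
    rw [Finset.sum_comm]
    refine Finset.sum_congr rfl fun J _ => ?_
    rw [← TensorProduct.tmul_sum]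
    congr 1
    conv_lhs => rw [← B.linearCombination_repr (opWord f (List.ofFn J.1))]
    rw [Finsupp.linearCombination_apply, Finsupp.sum_of_support_subset (s := S)]
    · simp only [hB]
      rfl
    · exact Finset.subset_biUnion_of_mem (fun J : MultiIndex k =>
        (B.repr (opWord f (List.ofFn J.1))).support) (Finset.mem_univ J)
    · simp
  · intro ω hω
    ext1 p
    rw [hω.apply_eq f B hB, Finsupp.onFinset_apply]

end Expansion

end CanonicalForm

end

/-! ### The product formula for a simple Lie algebra -/

theorem mainTheorem5 {L : Type*} [LieRing L] [LieAlgebra ℂ L] [FiniteDimensional ℂ L]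
    [LieAlgebra.IsSimple ℂ L] (H : LieSubalgebra ℂ L) [H.IsCartanSubalgebra]
    (b : (LieAlgebra.IsKilling.rootSystem H).Base) {r m : ℕ}
    (α : Fin r ≃ b.support) (f : Fin r → CanonicalForm.nilSubalgebra b)
    (hf : ∀ i, f i ∈ CanonicalForm.negRootSpace b (α i) ∧ f i ≠ 0)
    (β : Fin m ≃ {β : H.root // b.IsPos β}) (F : Fin m → CanonicalForm.nilSubalgebra b)
    (hF : ∀ l, F l ∈ CanonicalForm.negRootSpace b (β l) ∧ F l ≠ 0) :
    (∀ l, ∃! k : Fin r → ℕ,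
      CanonicalForm.HasContent f (UniversalEnvelopingAlgebra.ι ℂ (F l)) k) ∧
    (∀ k : Fin r → ℕ, ∃! Ω : CanonicalForm.skewForms k ⊗[ℂ] CanonicalForm.freePart k,
      CanonicalForm.IsCanonicalForm k Ω) ∧
    ∀ κ : Fin m → Fin r → ℕ,
      (∀ l, CanonicalForm.HasContent f (UniversalEnvelopingAlgebra.ι ℂ (F l)) (κ l)) →
    ∀ Ω : (k : Fin r → ℕ) → CanonicalForm.skewForms k ⊗[ℂ] CanonicalForm.freePart k,
      (∀ k, CanonicalForm.IsCanonicalForm k (Ω k)) →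
      (∀ k, ∃! ω : (Fin m → ℕ) →₀ CanonicalForm.skewForms k,
        CanonicalForm.IsPBWExpansion f F (CanonicalForm.lieForm f (Ω k)) ω) ∧
      ∃ η : (l : Fin m) → CanonicalForm.RatFn (CanonicalForm.Vars (κ l)),
        (∀ l, CanonicalForm.IsSymm (η l)) ∧
        ∀ (k : Fin r → ℕ) (ω : (Fin m → ℕ) →₀ CanonicalForm.skewForms k),
          CanonicalForm.IsPBWExpansion f F (CanonicalForm.lieForm f (Ω k)) ω →
          ∀ p : Fin m → ℕ, CanonicalForm.HasContent f (CanonicalForm.pbwMonomial F p) k →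
            (⟨k, (ω p : CanonicalForm.RatFn (CanonicalForm.Vars k))⟩ : CanonicalForm.GradedFn r) =
              CanonicalForm.scale (∏ l, ((p l).factorial : ℂ))⁻¹
                (CanonicalForm.starMonomial η p) := by
  have hunique : ∀ {x : UniversalEnvelopingAlgebra ℂ (CanonicalForm.nilSubalgebra b)}, x ≠ 0 →
      ∀ {k k' : Fin r → ℕ}, CanonicalForm.HasContent f x k → CanonicalForm.HasContent f x k' →
        k = k' := fun hx _ _ hk hk' => CanonicalForm.HasContent.unique hF hf hx hk hk'
  let B := CanonicalForm.pbwBasis hF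
  have hB : ∀ p, B p = CanonicalForm.pbwMonomial F p := CanonicalForm.pbwBasis_apply hF
  refine ⟨fun l => ?_, CanonicalForm.existsUnique_isCanonicalForm, ?_⟩
  · obtain ⟨k, hk⟩ := CanonicalForm.exists_content hf (β l).2
    refine ⟨k, hk _ (hF l).1, fun k' hk' => hunique ?_ hk' (hk _ (hF l).1)⟩
    rw [← CanonicalForm.pbwMonomial_single, ← hB]
    exact B.ne_zero _
  intro κ hκ Ω hΩ
  obtain rfl : Ω = CanonicalForm.canonicalElement := funext fun k => (hΩ k).eq_canonicalElement
  have hcoord : ∀ (w : List (Fin r)) (p : Fin m → ℕ), B.coord p (CanonicalForm.opWord f w) ≠ 0 →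
      ∑ l, p l • κ l = fun i => w.count i := fun w p hp =>
    CanonicalForm.hasContent_of_coord_ne_zero hF hf hκ
      (CanonicalForm.hasContent_opWord f fun _ => rfl) hp
  refine ⟨fun k => CanonicalForm.existsUnique_isPBWExpansion f B hB fun w p hp => ?_,
    -- `η_l` is the form of the functional that reads off the coefficient of `F_l`.
    fun l => CanonicalForm.formOf (κ l) (CanonicalForm.wordValue f (B.coord (Pi.single l 1))),
    fun l => (CanonicalForm.formOf_mem_skewForms _ _).2, ?_⟩
  · rw [← hcoord w p hp]
    exact CanonicalForm.hasContent_pbwMonomial hκ p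
  intro k ω hω p hp
  have hk : k = ∑ l, p l • κ l :=
    hunique (hB p ▸ B.ne_zero p) hp (CanonicalForm.hasContent_pbwMonomial hκ p)
  -- A word with nonzero coordinate at `F_l` has content `κ l`, which is the support condition on
  -- the left factor of a star product.
  have hsupp : ∀ l, CanonicalForm.SupportedOn (κ l)
      (CanonicalForm.wordValue f (B.coord (Pi.single l 1))) := by
    intro l w hw i
    have h := congrFun (hcoord w _ hw) i
    rw [← h]
    rw [Finset.sum_eq_single l (by simp +contextual) (by simp), Pi.single_eq_same, one_smul]
  have hfac : (∏ l, ((p l).factorial : ℂ)) ≠ 0 :=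
    Finset.prod_ne_zero_iff.mpr fun l _ => Nat.cast_ne_zero.mpr (Nat.factorial_ne_zero _)
  rw [CanonicalForm.starMonomial_eq_starProd,
    CanonicalForm.starProd_map_coord f B hB κ hsupp, hω.apply_eq f B hB]
  simp only [CanonicalForm.count_sortedList]
  subst hk
  -- The star product has degree `∑ l, p l • κ l` only up to a propositional equality of exponents;
  -- the two degrees are made identical before the functions are compared.
  rw [show ∑ l, (CanonicalForm.sortedList p).count l • κ l = ∑ l, p l • κ l by
    simp only [CanonicalForm.count_sortedList]]
  refine congrArg (Sigma.mk _) ?_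
  change CanonicalForm.formOf _ _ = (∏ l, ((p l).factorial : ℂ))⁻¹ • CanonicalForm.formOf _
    ((∏ l, ((p l).factorial : ℂ)) • CanonicalForm.wordValue f (B.coord p))
  rw [CanonicalForm.formOf_smul, inv_smul_smul₀ hfac]
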